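/- Let $d\ge 1$, let $\Omega\subset\mathbb R^d$ be a bounded domain (nonempty, open, connected), and let $p\in(1,2]$, $1/p+1/p^\ast=1$. Write $(\cdot,\cdot)$ for the integral over $\Omega$ of the pointwise product, let $|\cdot|$ be the Euclidean (for matrices: Frobenius) norm, and let row $i$ of $\nabla\chi$ be the gradient of $\chi_i$. Let $f\in L^\infty(\Omega)$, let $j:H^1_0(\Omega)\to L^1(\Omega)$ be (directionally) differentiable with $j'(u)\in L^2(\Omega)$ for all $u\in H_0^1(\Omega)$, and let $u_\Omega,y_\Omega\in H^1_0(\Omega)$ solve $$(\nabla u_\Omega,\nabla v)=(f,v),\qquad (\nabla y_\Omega,\nabla v)=-(j'(u_\Omega),v)\qquad\text{for all } v\in H^1_0(\Omega).$$ Put $K=(\nabla u_\Omega\cdot\nabla y_\Omega)I-\nabla y_\Omega\otimes\nabla u_\Omega-\nabla u_\Omega\otimes\nabla y_\Omega$ (the Sturm–Laurain shape tensor) and, for $\chi\in W^{1,p^\ast}(\Omega;\mathbb R^d)$, $$F(\chi)=(f\,\nabla y_\Omega,\chi)+(j(u_\Omega),\operatorname{div}\chi),\qquad J'(\Omega)[\chi]=(K,\nabla\chi)+F(\chi).$$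 For $T\in L^p(\Omega;\mathbb R^{d\times d})$ with (row-wise) $\operatorname{div}T\in L^p(\Omega;\mathbb R^d)$ let $\langle T\cdot n,\chi\rangle=(T,\nabla\chi)+(\operatorname{div}T,\chi)$, and let $\Sigma^{p,0}$ be the space of those $T$ with $\langle T\cdot n,\chi\rangle=0$ for all $\chi\in W^{1,p^\ast}(\Omega;\mathbb R^d)$. A field $T\in L^p(\Omega;\mathbb R^{d\times d})$ is called admissible if $\operatorname{div}T=F$ with $T\cdot n=0$ on $\partial\Omega$ in the weak sense, i.e. $-(T,\nabla\chi)=F(\chi)$ for all $\chi\in W^{1,p^\ast}(\Omega;\mathbb R^d)$. (If some $T\in\Sigma^{p,0}$ satisfies $(\operatorname{div}T,\chi)=F(\chi)$ for all such $\chi$, then the admissible fields are exactly the fields with this property.) Let $$\eta_p(\Omega)=\inf\{\|T-K\|_{L^p(\Omega)} : T\text{ admissible}\}.$$ A pair $(S,\theta)$ solves the KKT system if $S$ is admissible, $\theta\in W^{1,p^\ast}(\Omega;\mathbb R^d)$, and $$(|S-K|^{p-2}(S-K),T)+(\operatorname{div}T,\theta)=0\qquad\text{for all } T\in\Sigma^{p,0}.$$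 Assume that * $L^{p^\ast}(\Omega;\mathbb R^d)=G\oplus H$, where $G=\{\nabla\vartheta:\vartheta\in W^{1,p^\ast}(\Omega)\}$ and $H$ is the space of weakly divergence-free $w\in L^{p^\ast}(\Omega;\mathbb R^d)$ with vanishing normal trace, i.e. $(w,\nabla\chi)=0$ for all $\chi\in W^{1,p}(\Omega)$ (Helmholtz decomposition, applied to each row of a matrix field); * $K\in L^p(\Omega;\mathbb R^{d\times d})$ and $j(u_\Omega)\in L^2(\Omega)$; * $(f\,\nabla y_\Omega,e)=0$ for all constant $e\in\mathbb R^d$. Then the KKT system has a solution $(S,\theta)$, $$\sup_{\chi}\frac{J'(\Omega)[\chi]}{\|\nabla\chi\|_{L^{p^\ast}(\Omega)}}=\eta_p(\Omega),$$ where the supremum is over all $\chi\in W^{1,p^\ast}(\Omega;\mathbb R^d)$ with $\nabla\chi\neq0$, and for every solution $(S,\theta)$ of the KKT system one has $\nabla\theta=0$ if and only if $\eta_p(\Omega)=0$, and $$-\frac{J'(\Omega)[\theta]}{\|\nabla\theta\|_{L^{p^\ast}(\Omega)}}=\eta_p(\Omega)\qquad\text{whenever }\nabla\theta\neq0 .$$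 -/

import Mathlib

open MeasureTheory Filter Topology
open scoped ENNReal ContDiff RealInnerProductSpace

noncomputable section

namespace ShapeLp

/-- `ℝ^d` with the Euclidean norm. -/
abbrev Vec (d : ℕ) := EuclideanSpace ℝ (Fin d)

/-- `ℝ^{d × d}` with the Frobenius norm and the inner product `A : B = ∑ A_{ik} B_{ik}`;
the entry in row `i` and column `k` of `M` is `M (i, k)`. -/
abbrev Mat (d : ℕ) := EuclideanSpace ℝ (Fin d × Fin d)

variable {d : ℕ}

/-- Lebesgue measure on `Ω`. -/
abbrev vol (Ω : Set (Vec d)) : Measure (Vec d) := volume.restrict Ω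

/-- Test functions: `φ ∈ C_c^∞(Ω)`. -/
structure IsTest (Ω : Set (Vec d)) (φ : Vec d → ℝ) : Prop where
  smooth : ContDiff ℝ ∞ φ
  compact : HasCompactSupport φ
  subset : tsupport φ ⊆ Ω

/-! ### Weak gradients and Sobolev spaces -/

/-- `g` is a weak gradient of the scalar function `u` on `Ω`. -/
structure IsWeakGrad (Ω : Set (Vec d)) (u : Vec d → ℝ) (g : Vec d → Vec d) : Prop where
  locInt : LocallyIntegrableOn u Ω
  locInt_grad : LocallyIntegrableOn g Ω
  byParts : ∀ φ, IsTest Ω φ → ∀ v : Vec d,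
    ∫ x in Ω, u x * fderiv ℝ φ x v = - ∫ x in Ω, φ x * ⟪g x, v⟫

open Classical in
/-- The weak gradient `∇u` on `Ω` (unique almost everywhere on an open set; `0` if there is
none). -/
def weakGrad (Ω : Set (Vec d)) (u : Vec d → ℝ) : Vec d → Vec d :=
  if h : ∃ g, IsWeakGrad Ω u g then h.choose else 0

/-- `u ∈ W^{1,r}(Ω)`. -/
def MemW1 (r : ℝ≥0∞) (Ω : Set (Vec d)) (u : Vec d → ℝ) : Prop :=
  MemLp u r (vol Ω) ∧ ∃ g, IsWeakGrad Ω u g ∧ MemLp g r (vol Ω)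

/-- `χ ∈ W^{1,r}(Ω; ℝ^d)`. -/
def MemW1Vec (r : ℝ≥0∞) (Ω : Set (Vec d)) (χ : Vec d → Vec d) : Prop :=
  ∀ i, MemW1 r Ω (fun x => χ x i)

/-- The weak Jacobian `∇χ` of a vector field: row `i` is the gradient of the component `χ_i`. -/
def weakJac (Ω : Set (Vec d)) (χ : Vec d → Vec d) (x : Vec d) : Mat d :=
  WithLp.toLp 2 fun ik => weakGrad Ω (fun z => χ z ik.1) x ik.2

/-- The divergence `div χ` of a vector field in a Sobolev space. -/
def divW1 (Ω : Set (Vec d)) (χ : Vec d → Vec d) (x : Vec d) : ℝ :=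
  ∑ i, weakJac Ω χ x (i, i)

/-- `u ∈ H_0^1(Ω)`, the closure of `C_c^∞(Ω)` in `H^1(Ω)`. -/
def MemH10 (Ω : Set (Vec d)) (u : Vec d → ℝ) : Prop :=
  MemW1 2 Ω u ∧ ∀ ε : ℝ≥0∞, 0 < ε → ∃ φ, IsTest Ω φ ∧
    eLpNorm (u - φ) 2 (vol Ω) ≤ ε ∧
    eLpNorm (weakGrad Ω u - gradient φ) 2 (vol Ω) ≤ ε

/-- `u ∈ H_0^1(Ω)` solves `(∇u, ∇v) = (f, v)` for all `v ∈ H_0^1(Ω)`. -/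
structure IsDirichletSolution (Ω : Set (Vec d)) (f u : Vec d → ℝ) : Prop where
  mem : MemH10 Ω u
  weak : ∀ v, MemH10 Ω v →
    ∫ x in Ω, ⟪weakGrad Ω u x, weakGrad Ω v x⟫ = ∫ x in Ω, f x * v x

/-! ### The integrand of the shape functional -/

/-- `j` maps `H_0^1(Ω)` to `L^1(Ω)` (functions being identified when they agree almost everywhere)
and is differentiable there, with derivative at `u` the multiplication `v ↦ j'(u) v` by a function
`j'(u) ∈ L^2(Ω)`. Only directional derivatives are required, with difference quotients that
converge in `L^1(Ω)`. -/
structure IsShapeIntegrand (Ω : Set (Vec d)) (j j' : (Vec d → ℝ) → (Vec d → ℝ)) : Prop where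
  congr : ∀ u v, MemH10 Ω u → MemH10 Ω v → u =ᵐ[vol Ω] v → j u =ᵐ[vol Ω] j v
  memL1 : ∀ u, MemH10 Ω u → MemLp (j u) 1 (vol Ω)
  deriv_memL2 : ∀ u, MemH10 Ω u → MemLp (j' u) 2 (vol Ω)
  hasDeriv : ∀ u, MemH10 Ω u → ∀ v, MemH10 Ω v →
    Tendsto (fun t : ℝ => eLpNorm
      (fun x => t⁻¹ * (j (fun z => u z + t * v z) x - j u x) - j' u x * v x) 1 (vol Ω))
      (𝓝[≠] 0) (𝓝 0)

/-! ### The shape tensor and the shape derivative -/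

/-- `K(u, y) = (∇u · ∇y) I - ∇y ⊗ ∇u - ∇u ⊗ ∇y`. -/
def shapeTensor (Ω : Set (Vec d)) (u y : Vec d → ℝ) (x : Vec d) : Mat d :=
  WithLp.toLp 2 fun ik =>
    (if ik.1 = ik.2 then ⟪weakGrad Ω u x, weakGrad Ω y x⟫ else 0)
      - weakGrad Ω y x ik.1 * weakGrad Ω u x ik.2
      - weakGrad Ω u x ik.1 * weakGrad Ω y x ik.2

/-- The functional `F(χ) = (f ∇y, χ) + (j(u), div χ)`; `ju` stands for `j(u)`. -/
def loadFunctional (Ω : Set (Vec d)) (f ju y : Vec d → ℝ) (χ : Vec d → Vec d) : ℝ :=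
  (∫ x in Ω, f x * ⟪weakGrad Ω y x, χ x⟫) + ∫ x in Ω, ju x * divW1 Ω χ x

/-- The shape derivative in volume form,
`J'(Ω)[χ] = (K(u, y), ∇χ) + (f ∇y, χ) + (j(u), div χ)`; `ju` stands for `j(u)`. -/
def shapeDeriv (Ω : Set (Vec d)) (f ju u y : Vec d → ℝ) (χ : Vec d → Vec d) : ℝ :=
  (∫ x in Ω, ⟪shapeTensor Ω u y x, weakJac Ω χ x⟫) + loadFunctional Ω f ju y χ

/-! ### Divergence and normal trace of tensor fields -/

/-- The `i`-th row of a tensor field. -/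
def row (T : Vec d → Mat d) (i : Fin d) (x : Vec d) : Vec d :=
  WithLp.toLp 2 fun k => T x (i, k)

/-- `D` is the weak (row-wise) divergence of `T` on `Ω`. -/
structure IsWeakDiv (Ω : Set (Vec d)) (T : Vec d → Mat d) (D : Vec d → Vec d) : Prop where
  locInt : LocallyIntegrableOn T Ω
  locInt_div : LocallyIntegrableOn D Ω
  byParts : ∀ φ, IsTest Ω φ → ∀ i,
    ∫ x in Ω, ⟪row T i x, gradient φ x⟫ = - ∫ x in Ω, φ x * D x i

open Classical in
/-- The weak divergence `div T` on `Ω` (unique almost everywhere on an open set; `0` if there is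
none). -/
def weakDiv (Ω : Set (Vec d)) (T : Vec d → Mat d) : Vec d → Vec d :=
  if h : ∃ D, IsWeakDiv Ω T D then h.choose else 0

/-- `Σ^p = {T ∈ L^p(Ω; ℝ^{d × d}) : div T ∈ L^p(Ω; ℝ^d)}`. -/
def MemSigma (p : ℝ) (Ω : Set (Vec d)) (T : Vec d → Mat d) : Prop :=
  MemLp T (.ofReal p) (vol Ω) ∧ ∃ D, IsWeakDiv Ω T D ∧ MemLp D (.ofReal p) (vol Ω)

/-- The normal trace `⟨T · n, χ|_∂Ω⟩ = (T, ∇χ) + (div T, χ)` of `T ∈ Σ^p`. -/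
def normalTrace (Ω : Set (Vec d)) (T : Vec d → Mat d) (χ : Vec d → Vec d) : ℝ :=
  (∫ x in Ω, ⟪T x, weakJac Ω χ x⟫) + ∫ x in Ω, ⟪weakDiv Ω T x, χ x⟫

/-- `Σ^{p,0} = {T ∈ Σ^p : ⟨T · n, χ|_∂Ω⟩ = 0 for all χ ∈ W^{1,q}(Ω; ℝ^d)}`, where `q` is the
conjugate exponent of `p`. -/
def MemSigma0 (p q : ℝ) (Ω : Set (Vec d)) (T : Vec d → Mat d) : Prop :=
  MemSigma p Ω T ∧ ∀ χ, MemW1Vec (.ofReal q) Ω χ → normalTrace Ω T χ = 0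

/-- The admissible tensor fields: `T ∈ L^p(Ω; ℝ^{d × d})` with `div T = F` in `Ω` and `T · n = 0` on
`∂Ω`, both in the weak sense. As `F` is merely a functional on `W^{1,q}(Ω; ℝ^d)`, so is `div T`:
for vanishing normal trace, `(div T, χ)` is `-(T, ∇χ)`. When some field in `Σ^{p,0}` has `(div T, χ) = F(χ)`
for all `χ`, the admissible fields are exactly those in `Σ^{p,0}` with this property; see
`isAdmissible_iff_of_exists`. -/
def IsAdmissible (p q : ℝ) (Ω : Set (Vec d)) (f ju y : Vec d → ℝ) (T : Vec d → Mat d) : Prop :=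
  MemLp T (.ofReal p) (vol Ω) ∧ ∀ χ, MemW1Vec (.ofReal q) Ω χ →
    - ∫ x in Ω, ⟪T x, weakJac Ω χ x⟫ = loadFunctional Ω f ju y χ

/-- `η_p(Ω)`, the `L^p` distance of `K(u, y)` to the admissible tensor fields. -/
def eta (p q : ℝ) (Ω : Set (Vec d)) (f ju u y : Vec d → ℝ) : ℝ :=
  sInf {r | ∃ T, IsAdmissible p q Ω f ju y T ∧
    r = lpNorm (fun x => T x - shapeTensor Ω u y x) (.ofReal p) (vol Ω)}

/-- The KKT system for `(S, θ)`: `S` is admissible, `θ ∈ W^{1,q}(Ω; ℝ^d)`, and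
`(|S - K|^{p-2} (S - K), T) + (div T, θ) = 0` for all `T ∈ Σ^{p,0}`. -/
structure IsKKT (p q : ℝ) (Ω : Set (Vec d)) (f ju u y : Vec d → ℝ)
    (S : Vec d → Mat d) (θ : Vec d → Vec d) : Prop where
  admissible : IsAdmissible p q Ω f ju y S
  memW1 : MemW1Vec (.ofReal q) Ω θ
  stationary : ∀ T, MemSigma0 p q Ω T →
    (∫ x in Ω, ⟪‖S x - shapeTensor Ω u y x‖ ^ (p - 2) • (S x - shapeTensor Ω u y x), T x⟫)
      + ∫ x in Ω, ⟪weakDiv Ω T x, θ x⟫ = 0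

/-! ### Helmholtz decomposition -/

/-- `w ∈ H_q(Ω)`: `w ∈ L^q(Ω; ℝ^d)` is weakly divergence-free with vanishing normal trace. The
normal trace is tested with `W^{1,p}(Ω)`, where `p` is the conjugate exponent of `q`; for `w` without
divergence it is `χ ↦ (w, ∇χ)`. -/
structure MemSolenoidal (p q : ℝ) (Ω : Set (Vec d)) (w : Vec d → Vec d) : Prop where
  memLp : MemLp w (.ofReal q) (vol Ω)
  divFree : ∀ φ, IsTest Ω φ → ∫ x in Ω, ⟪w x, gradient φ x⟫ = 0
  traceFree : ∀ χ, MemW1 (.ofReal p) Ω χ → ∫ x in Ω, ⟪w x, weakGrad Ω χ x⟫ = 0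

/-- The Helmholtz decomposition `L^q(Ω; ℝ^d) = G_q(Ω) ⊕ H_q(Ω)`, where
`G_q(Ω) = {∇ϑ : ϑ ∈ W^{1,q}(Ω)}`. It is applied to each row of a tensor field. -/
structure HasHelmholtz (p q : ℝ) (Ω : Set (Vec d)) : Prop where
  sum : ∀ v : Vec d → Vec d, MemLp v (.ofReal q) (vol Ω) →
    ∃ ϑ w, MemW1 (.ofReal q) Ω ϑ ∧ MemSolenoidal p q Ω w ∧
      v =ᵐ[vol Ω] fun x => weakGrad Ω ϑ x + w x
  direct : ∀ ϑ, MemW1 (.ofReal q) Ω ϑ → MemSolenoidal p q Ω (weakGrad Ω ϑ) →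
    weakGrad Ω ϑ =ᵐ[vol Ω] 0

/-! ### Consistency of the admissible class -/

lemma IsTest.integrable_smul {Ω : Set (Vec d)} {φ : Vec d → ℝ} (hφ : IsTest Ω φ)
    {F : Type*} [NormedAddCommGroup F] [NormedSpace ℝ F]
    {g : Vec d → F} (hg : LocallyIntegrableOn g Ω) :
    Integrable (fun x => φ x • g x) := by
  have h1 : IntegrableOn g (tsupport φ) :=
    hg.integrableOn_compact_subset hφ.subset hφ.compact
  have h2 : IntegrableOn (fun x => φ x • g x) (tsupport φ) :=
    h1.continuousOn_smul hφ.smooth.continuous.continuousOn hφ.compact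
  refine (integrableOn_iff_integrable_of_support_subset ?_).1 h2
  intro x hx
  refine subset_tsupport φ ?_
  intro h0
  exact hx (by simp [h0])

lemma IsTest.setIntegral_smul {Ω : Set (Vec d)} {φ : Vec d → ℝ} (hφ : IsTest Ω φ)
    {F : Type*} [NormedAddCommGroup F] [NormedSpace ℝ F] (g : Vec d → F) :
    ∫ x in Ω, φ x • g x = ∫ x, φ x • g x := by
  refine setIntegral_eq_integral_of_forall_compl_eq_zero fun x hx => ?_
  have : φ x = 0 := by
    by_contra h
    exact hx (hφ.subset (subset_tsupport φ h))
  simp [this]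

lemma ae_eq_of_forall_test {Ω : Set (Vec d)} (hΩ : IsOpen Ω) {g h : Vec d → Vec d}
    (hg : LocallyIntegrableOn g Ω) (hh : LocallyIntegrableOn h Ω)
    (H : ∀ φ, IsTest Ω φ → ∀ i, ∫ x in Ω, φ x * g x i = ∫ x in Ω, φ x * h x i) :
    g =ᵐ[vol Ω] h := by
  have key : ∀ᵐ x, x ∈ Ω → g x - h x = 0 := by
    refine hΩ.ae_eq_zero_of_integral_contDiff_smul_eq_zero (hg.sub hh) ?_
    intro φ h1 h2 h3
    have hφ : IsTest Ω φ := ⟨h1, h2, h3⟩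
    have hig := hφ.integrable_smul hg
    have hih := hφ.integrable_smul hh
    simp only [smul_sub]
    rw [integral_sub hig hih, sub_eq_zero]
    ext i
    have e : ∀ k : Vec d → Vec d, Integrable (fun x => φ x • k x) →
        (∫ x, φ x • k x) i = ∫ x in Ω, φ x * k x i := by
      intro k hk
      have := (EuclideanSpace.proj i : Vec d →L[ℝ] ℝ).integral_comp_comm hk
      have h4 := hφ.setIntegral_smul (fun x => k x i)
      simp only [smul_eq_mul] at h4
      rw [h4]
      simpa using this.symm
    rw [e g hig, e h hih, H φ hφ i]
  refine (ae_restrict_iff' hΩ.measurableSet).2 ?_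
  filter_upwards [key] with x hx hxΩ using sub_eq_zero.1 (hx hxΩ)

/-- The weak gradient is unique. -/
lemma IsWeakGrad.weakGrad_ae {Ω : Set (Vec d)} (hΩ : IsOpen Ω) {u : Vec d → ℝ}
    {g : Vec d → Vec d} (hg : IsWeakGrad Ω u g) : weakGrad Ω u =ᵐ[vol Ω] g := by
  have h : ∃ g, IsWeakGrad Ω u g := ⟨g, hg⟩
  have hc : IsWeakGrad Ω u (weakGrad Ω u) := by
    rw [weakGrad, dif_pos h]; exact h.choose_spec
  refine ae_eq_of_forall_test hΩ hc.locInt_grad hg.locInt_grad fun φ hφ i => ?_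
  have h1 := hc.byParts φ hφ (EuclideanSpace.single i 1)
  have h2 := hg.byParts φ hφ (EuclideanSpace.single i 1)
  rw [h1] at h2
  simpa [EuclideanSpace.inner_single_right] using h2

/-- The weak divergence is unique. -/
lemma IsWeakDiv.weakDiv_ae {Ω : Set (Vec d)} (hΩ : IsOpen Ω) {T : Vec d → Mat d}
    {D : Vec d → Vec d} (hD : IsWeakDiv Ω T D) : weakDiv Ω T =ᵐ[vol Ω] D := by
  have h : ∃ D, IsWeakDiv Ω T D := ⟨D, hD⟩
  have hc : IsWeakDiv Ω T (weakDiv Ω T) := by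
    rw [weakDiv, dif_pos h]; exact h.choose_spec
  refine ae_eq_of_forall_test hΩ hc.locInt_div hD.locInt_div fun φ hφ i => ?_
  have h1 := hc.byParts φ hφ i
  rw [hD.byParts φ hφ i] at h1
  linarith

/-- Test functions have their gradient as weak gradient. -/
lemma IsTest.isWeakGrad {Ω : Set (Vec d)} {φ : Vec d → ℝ} (hφ : IsTest Ω φ) :
    IsWeakGrad Ω φ (gradient φ) := by
  have hgr : Continuous (gradient φ) :=
    (InnerProductSpace.toDual ℝ (Vec d)).symm.continuous.comp
      (hφ.smooth.continuous_fderiv (by simp))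
  refine ⟨hφ.smooth.continuous.locallyIntegrable.locallyIntegrableOn _,
    hgr.locallyIntegrable.locallyIntegrableOn _, fun ψ hψ v => ?_⟩
  have c1 : Continuous fun x => fderiv ℝ φ x v :=
    (hφ.smooth.continuous_fderiv (by simp)).clm_apply continuous_const
  have c2 : Continuous fun x => fderiv ℝ ψ x v :=
    (hψ.smooth.continuous_fderiv (by simp)).clm_apply continuous_const
  have I1 : Integrable fun x => fderiv ℝ ψ x v * φ x :=
    (c2.mul hφ.smooth.continuous).integrable_of_hasCompactSupport hφ.compact.mul_left
  have I2 : Integrable fun x => ψ x * fderiv ℝ φ x v :=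
    (hψ.smooth.continuous.mul c1).integrable_of_hasCompactSupport hψ.compact.mul_right
  have I3 : Integrable fun x => ψ x * φ x :=
    (hψ.smooth.continuous.mul hφ.smooth.continuous).integrable_of_hasCompactSupport
      hψ.compact.mul_right
  have key := integral_mul_fderiv_eq_neg_fderiv_mul_of_integrable I1 I2 I3
    (fun x _ => (hψ.smooth.differentiable (by simp)) x)
    (fun x _ => (hφ.smooth.differentiable (by simp)) x)
  have e1 := hφ.setIntegral_smul (fun x => fderiv ℝ ψ x v)
  have e2 := hψ.setIntegral_smul (fun x => ⟪gradient φ x, v⟫)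
  simp only [smul_eq_mul] at e1 e2
  rw [e1, e2]
  have e3 : ∀ x, ⟪gradient φ x, v⟫ = fderiv ℝ φ x v := fun x => by
    simp [gradient]
  simp only [e3, key, neg_neg]
  exact integral_congr_ae (.of_forall fun x => mul_comm _ _)

/-- The field `φ e_i` built from a test function `φ` belongs to every Sobolev space. -/
lemma IsTest.memW1Vec {Ω : Set (Vec d)} {φ : Vec d → ℝ} (hφ : IsTest Ω φ) (r : ℝ≥0∞)
    (i : Fin d) : MemW1Vec r Ω (fun x => EuclideanSpace.single i (φ x)) := by
  intro k
  by_cases hk : k = i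
  · subst hk
    simp only [PiLp.single_apply, if_true]
    have hgr : Continuous (gradient φ) :=
      (InnerProductSpace.toDual ℝ (Vec d)).symm.continuous.comp
        (hφ.smooth.continuous_fderiv (by simp))
    have hgc : HasCompactSupport (gradient φ) :=
      (hφ.compact.fderiv ℝ).comp_left (g := (InnerProductSpace.toDual ℝ (Vec d)).symm) (by simp)
    exact ⟨(hφ.smooth.continuous.memLp_of_hasCompactSupport hφ.compact).restrict _,
      gradient φ, hφ.isWeakGrad, (hgr.memLp_of_hasCompactSupport hgc).restrict _⟩
  · simp only [PiLp.single_apply, if_neg hk]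
    refine ⟨MemLp.zero', 0, ⟨?_, ?_, ?_⟩, MemLp.zero⟩
    · exact (locallyIntegrable_const 0).locallyIntegrableOn _
    · exact (locallyIntegrable_const 0).locallyIntegrableOn _
    · simp

lemma IsTest.inner_weakJac {Ω : Set (Vec d)} (hΩ : IsOpen Ω) {φ : Vec d → ℝ}
    (hφ : IsTest Ω φ) (i : Fin d) (T : Vec d → Mat d) :
    ∀ᵐ x ∂(vol Ω), ⟪T x, weakJac Ω (fun z => EuclideanSpace.single i (φ z)) x⟫ =
      ⟪row T i x, gradient φ x⟫ := by
  have h0 : IsWeakGrad Ω (fun _ : Vec d => (0 : ℝ)) 0 :=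
    ⟨(locallyIntegrable_const 0).locallyIntegrableOn _,
      (locallyIntegrable_const 0).locallyIntegrableOn _, by simp⟩
  filter_upwards [hφ.isWeakGrad.weakGrad_ae hΩ, h0.weakGrad_ae hΩ] with x h1 h2
  have h3 : ∀ k l, weakJac Ω (fun z => EuclideanSpace.single i (φ z)) x (k, l) =
      if k = i then gradient φ x l else 0 := by
    intro k l
    by_cases hk : k = i
    · subst hk; simp [weakJac, h1]
    · simp [weakJac, hk, h2]
  generalize gradient φ x = g at h3
  simp [PiLp.inner_apply, Fintype.sum_prod_type, h3, row]

/-- A field in `Σ^{p,0}` whose divergence represents `F` is admissible. Conversely, as soon as one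
such field exists, every admissible field is of this kind. -/
theorem isAdmissible_iff_of_exists {Ω : Set (Vec d)} (hΩ : IsOpen Ω) {p q : ℝ} (hp : 1 ≤ p)
    {f ju y : Vec d → ℝ} {T₀ : Vec d → Mat d} (hT₀ : MemSigma0 p q Ω T₀)
    (hF : ∀ χ, MemW1Vec (.ofReal q) Ω χ →
      ∫ x in Ω, ⟪weakDiv Ω T₀ x, χ x⟫ = loadFunctional Ω f ju y χ)
    (T : Vec d → Mat d) :
    IsAdmissible p q Ω f ju y T ↔ MemSigma0 p q Ω T ∧ ∀ χ, MemW1Vec (.ofReal q) Ω χ →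
      ∫ x in Ω, ⟪weakDiv Ω T x, χ x⟫ = loadFunctional Ω f ju y χ := by
  constructor
  · rintro ⟨hTp, hT⟩
    obtain ⟨⟨-, D, hD, hDp⟩, htr⟩ := hT₀
    have hp' : (1 : ℝ≥0∞) ≤ .ofReal p := by
      simpa using ENNReal.ofReal_le_ofReal hp
    have hDT : IsWeakDiv Ω T D := by
      refine ⟨locallyIntegrableOn_of_locallyIntegrable_restrict (hTp.locallyIntegrable hp'),
        hD.locInt_div, fun φ hφ i => ?_⟩
      have hm := hφ.memW1Vec (.ofReal q) i
      rw [← integral_congr_ae (hφ.inner_weakJac hΩ i T), ← neg_eq_iff_eq_neg, hT _ hm, ← hF _ hm]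
      refine integral_congr_ae ?_
      filter_upwards [hD.weakDiv_ae hΩ] with x hx
      simp [hx, EuclideanSpace.inner_single_right]
    have hEq : weakDiv Ω T =ᵐ[vol Ω] weakDiv Ω T₀ :=
      (hDT.weakDiv_ae hΩ).trans (hD.weakDiv_ae hΩ).symm
    have hI : ∀ χ : Vec d → Vec d,
        ∫ x in Ω, ⟪weakDiv Ω T x, χ x⟫ = ∫ x in Ω, ⟪weakDiv Ω T₀ x, χ x⟫ := fun χ =>
      integral_congr_ae (by filter_upwards [hEq] with x hx; rw [hx])
    refine ⟨⟨⟨hTp, D, hDT, hDp⟩, fun χ hχ => ?_⟩, fun χ hχ => by rw [hI, hF χ hχ]⟩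
    rw [normalTrace, hI, hF χ hχ, ← hT χ hχ]
    ring
  · rintro ⟨⟨⟨hTp, -⟩, htr⟩, hT⟩
    refine ⟨hTp, fun χ hχ => ?_⟩
    have := htr χ hχ
    rw [normalTrace] at this
    rw [← hT χ hχ]
    linarith

end ShapeLp

end

open ShapeLp

noncomputable section

namespace ShapeLp

variable {d : ℕ}

/-! ### Functions with vanishing weak gradient -/

/-! The theorem is convex duality between gradients in `L^q`, `q` the conjugate exponent of `p`, and
tensor fields in `L^p`. For admissible `T` one has `J'(Ω)[χ] = -(T - K, ∇χ)`, so Hölder bounds the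
quotient by `‖T - K‖_p`, and the supremum is at most `η_p` (`IsAdmissible.abs_shapeDeriv_le`). A KKT
pair closes the gap: testing stationarity with single-entry tensors gives `∇θ = |S - K|^{p-2} (S -
K)` (`IsKKT.weakJac_ae`), the equality case of Hölder. Hence `S` realizes the distance, `‖∇θ‖_q =
η_p^{p-1}`, and `-θ` attains the supremum when `∇θ ≠ 0`.

A KKT pair comes from a minimizer `θ` of `‖∇χ‖_q^q / q + J'(Ω)[χ]` with `S = K + |∇θ|^{q-2} ∇θ`
(`exists_isKKT`). The Euler–Lagrange equation says that `S` is admissible. As `v ↦ |v|^{q-2} v` and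
`v ↦ |v|^{p-2} v` are mutually inverse, stationarity reduces to the vanishing normal trace of the
tensors in `Σ^{p,0}`, paired with `θ`.

The minimization takes place in the space of gradients, so that no Poincaré inequality is assumed.
The Helmholtz decomposition describes this space by orthogonality relations, hence it is closed in
`L^q` (`isClosed_jacobians`). By compatibility and connectedness (`IsWeakGrad.exists_const`),
`J'(Ω)` vanishes on fields with zero gradient; the open mapping theorem then makes it a bounded
functional of `∇χ` alone (`exists_clm_factor`). Since `p ≤ 2` means `q ≥ 2`, Clarkson's inequality
makes minimizing sequences Cauchy (`exists_minimizer`). -/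

/-- The mollification of a function with vanishing weak gradient is constant on balls. -/
lemma exists_const_convolution {Ω : Set (Vec d)} {u : Vec d → ℝ} (hu : IsWeakGrad Ω u 0)
    {x₀ : Vec d} {r : ℝ} (hB : Metric.closedBall x₀ (2 * r) ⊆ Ω)
    (b : ContDiffBump (0 : Vec d)) (hb : b.rOut < r) :
    ∃ c, ∀ x ∈ Metric.ball x₀ r,
      convolution (b.normed volume) ((Metric.closedBall x₀ (2 * r)).indicator u)
        (ContinuousLinearMap.lsmul ℝ ℝ) volume x = c := by
  set B := Metric.closedBall x₀ (2 * r)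
  set ψ := b.normed (volume : Measure (Vec d))
  have hψc : HasCompactSupport ψ := b.hasCompactSupport_normed
  have hψs : ContDiff ℝ ∞ ψ := b.contDiff_normed
  have hint : Integrable (B.indicator u) :=
    (hu.locInt.integrableOn_compact_subset hB (isCompact_closedBall _ _)).integrable_indicator
      Metric.isClosed_closedBall.measurableSet
  have hderiv := fun x => hψc.hasFDerivAt_convolution_left (ContinuousLinearMap.lsmul ℝ ℝ)
    (hψs.of_le (by simp)) hint.locallyIntegrable x
  refine Metric.isOpen_ball.exists_is_const_of_fderiv_eq_zero
    (convex_ball x₀ r).isPreconnected (fun x _ => (hderiv x).differentiableAt.differentiableWithinAt)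
    fun x hx => ?_
  rw [(hderiv x).fderiv]
  -- The derivative of the convolution is an integral of `u` against a derivative of this reflected
  -- mollifier. Its support stays within `b.rOut < r` of `x`, hence inside the ball of radius `2 *
  -- r`: it is a legitimate test function, and cutting `u` off outside that ball changes nothing.
  have hφ : IsTest Ω (fun s => ψ (x - s)) := by
    have hsub : tsupport (fun s => ψ (x - s)) ⊆ Metric.closedBall x b.rOut := by
      refine closure_minimal ?_ Metric.isClosed_closedBall
      intro s hs
      have : x - s ∈ Function.support ψ := hs
      rw [b.support_normed_eq, Metric.mem_ball, dist_zero_right] at this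
      rw [Metric.mem_closedBall, dist_comm, dist_eq_norm]
      exact this.le
    refine ⟨hψs.comp (contDiff_const.sub contDiff_id),
      HasCompactSupport.of_support_subset_isCompact (isCompact_closedBall x b.rOut)
        ((subset_tsupport _).trans hsub), hsub.trans (subset_trans ?_ hB)⟩
    refine Metric.closedBall_subset_closedBall' ?_
    have := Metric.mem_ball.1 hx
    linarith
  have hsupp : ∀ s v, s ∉ B → fderiv ℝ ψ (x - s) v = 0 := by
    intro s v hs
    have : x - s ∉ tsupport ψ := by
      rw [b.tsupport_normed_eq, Metric.mem_closedBall, dist_zero_right]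
      intro h
      apply hs
      rw [Metric.mem_closedBall]
      have h1 := Metric.mem_ball.1 hx
      have h2 := dist_triangle s x x₀
      rw [dist_comm s x, dist_eq_norm x s] at h2
      linarith
    rw [image_eq_zero_of_notMem_tsupport (fun h => this (tsupport_fderiv_subset ℝ h))]
    simp
  ext v
  have hci : ConvolutionExistsAt (fderiv ℝ ψ) (B.indicator u) x
      ((ContinuousLinearMap.lsmul ℝ ℝ).precompL (Vec d)) volume :=
    (hψc.fderiv ℝ).convolutionExists_left _ (hψs.continuous_fderiv (by simp))
      hint.locallyIntegrable x
  rw [convolution_def, ContinuousLinearMap.integral_apply hci]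
  have h1 := hu.byParts _ hφ v
  have h2 : ∀ s, fderiv ℝ (fun s => ψ (x - s)) s v = - fderiv ℝ ψ (x - s) v := by
    intro s
    have h3 := (hψs.differentiable (by simp) (x - s)).hasFDerivAt.comp s
      ((hasFDerivAt_id s).const_sub x)
    rw [show (fun s => ψ (x - s)) = ψ ∘ fun s => x - s from rfl]
    rw [h3.fderiv]
    simp
  simp only [h2, Pi.zero_apply, inner_zero_left, mul_zero, integral_zero, neg_zero] at h1
  calc ∫ t, ((ContinuousLinearMap.lsmul ℝ ℝ).precompL (Vec d)) (fderiv ℝ ψ t)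
          (B.indicator u (x - t)) v
      = ∫ t, fderiv ℝ ψ t v * B.indicator u (x - t) := by
        simp [ContinuousLinearMap.precompL_apply]
    _ = ∫ s, fderiv ℝ ψ (x - s) v * B.indicator u s := by
        rw [← integral_sub_left_eq_self _ volume x]
        simp
    _ = ∫ s, fderiv ℝ ψ (x - s) v * u s := by
        refine integral_congr_ae (.of_forall fun s => ?_)
        by_cases hs : s ∈ B
        · simp [hs]
        · simp [hsupp s v hs]
    _ = ∫ s in Ω, fderiv ℝ ψ (x - s) v * u s := by
        refine (setIntegral_eq_integral_of_forall_compl_eq_zero fun s hs => ?_).symm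
        simp [hsupp s v fun h => hs (hB h)]
    _ = 0 := by
        rw [← neg_eq_zero, ← h1, ← integral_neg]
        exact integral_congr_ae (.of_forall fun s => by ring)

/-- A function with vanishing weak gradient is constant near every point. -/
lemma IsWeakGrad.exists_const_nhds {Ω : Set (Vec d)} (hΩ : IsOpen Ω) {u : Vec d → ℝ}
    (hu : IsWeakGrad Ω u 0) {x₀ : Vec d} (hx₀ : x₀ ∈ Ω) :
    ∃ r > 0, ∃ c, ∀ᵐ x, x ∈ Metric.ball x₀ r → u x = c := by
  obtain ⟨ε, hε, hεΩ⟩ := Metric.nhds_basis_closedBall.mem_iff.1 (hΩ.mem_nhds hx₀)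
  set r := ε / 2 with hrdef
  have hr : 0 < r := by positivity
  have hB : Metric.closedBall x₀ (2 * r) ⊆ Ω := by
    rwa [hrdef, mul_div_cancel₀ _ two_ne_zero]
  -- The shift by `2` keeps the outer radius below `r` already at `n = 0`; the ratio `2` of the
  -- radii is the bound required for almost everywhere convergence of mollifications.
  let b : ℕ → ContDiffBump (0 : Vec d) := fun n =>
    ⟨r / (2 * (n + 2)), r / (n + 2), by positivity, by
      apply div_lt_div_of_pos_left hr (by positivity)
      have : (0 : ℝ) < n + 2 := by positivity
      linarith⟩
  have hout : ∀ n, (b n).rOut < r := fun n => by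
    change r / (n + 2) < r
    apply div_lt_self hr
    have : (0 : ℝ) ≤ n := by positivity
    linarith
  choose c hc using fun n => exists_const_convolution hu hB (b n) (hout n)
  have hint : Integrable ((Metric.closedBall x₀ (2 * r)).indicator u) :=
    (hu.locInt.integrableOn_compact_subset hB (isCompact_closedBall _ _)).integrable_indicator
      Metric.isClosed_closedBall.measurableSet
  have hlim := ContDiffBump.ae_convolution_tendsto_right_of_locallyIntegrable
    (μ := (volume : Measure (Vec d))) (φ := b) (l := atTop) (K := 2)
    (by
      change Tendsto (fun n : ℕ => r / ((n : ℝ) + 2)) atTop (𝓝 0)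
      exact tendsto_const_nhds.div_atTop
        (tendsto_atTop_add_const_right _ _ tendsto_natCast_atTop_atTop))
    (.of_forall fun n => by
      change r / (n + 2) ≤ 2 * (r / (2 * (n + 2)))
      apply le_of_eq
      field_simp)
    hint.locallyIntegrable
  -- At almost every point of the ball the constants `c n` converge to `u x`, so their limit cannot
  -- depend on `x`.
  refine ⟨r, hr, limUnder atTop c, ?_⟩
  filter_upwards [hlim] with x hx hxB
  have hxB' : x ∈ Metric.closedBall x₀ (2 * r) := by
    rw [Metric.mem_closedBall]; have := Metric.mem_ball.1 hxB; linarith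
  rw [Set.indicator_of_mem hxB'] at hx
  exact (Tendsto.limUnder_eq (hx.congr fun n => hc n x hxB)).symm

/-- On a connected open set, a function with vanishing weak gradient is constant. -/
theorem IsWeakGrad.exists_const {Ω : Set (Vec d)} (hΩ : IsOpen Ω) (hΩc : IsConnected Ω)
    {u : Vec d → ℝ} (hu : IsWeakGrad Ω u 0) : ∃ c, u =ᵐ[vol Ω] fun _ => c := by
  obtain ⟨x₀, hx₀⟩ := hΩc.nonempty
  obtain ⟨r₀, hr₀, c, hc⟩ := hu.exists_const_nhds hΩ hx₀
  -- Points near which `u` equals `c` almost everywhere, against those near which it equals another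
  -- constant. Both sets are open, and they are disjoint because a nonempty open set has positive
  -- measure.
  let A : Set (Vec d) := {x | ∃ U, IsOpen U ∧ x ∈ U ∧ ∀ᵐ z, z ∈ U → u z = c}
  let B : Set (Vec d) := {x | ∃ U, IsOpen U ∧ x ∈ U ∧ ∃ c' ≠ c, ∀ᵐ z, z ∈ U → u z = c'}
  have hA : IsOpen A := isOpen_iff_mem_nhds.2 fun x ⟨U, hU, hx, h⟩ =>
    mem_of_superset (hU.mem_nhds hx) fun z hz => ⟨U, hU, hz, h⟩
  have hB : IsOpen B := isOpen_iff_mem_nhds.2 fun x ⟨U, hU, hx, h⟩ =>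
    mem_of_superset (hU.mem_nhds hx) fun z hz => ⟨U, hU, hz, h⟩
  have hAB : Disjoint A B := by
    refine Set.disjoint_left.2 ?_
    rintro x ⟨U, hU, hxU, h1⟩ ⟨V, hV, hxV, c', hne, h2⟩
    have hpos : 0 < volume (U ∩ V) := (hU.inter hV).measure_pos _ ⟨x, hxU, hxV⟩
    refine hpos.ne' (measure_mono_null (fun z hz => ?_) (ae_iff.1 (h1.and h2)))
    rintro ⟨g1, g2⟩
    exact hne ((g2 hz.2).symm.trans (g1 hz.1))
  have hcov : Ω ⊆ A ∪ B := by
    intro x hx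
    obtain ⟨r, hr, c', h⟩ := hu.exists_const_nhds hΩ hx
    by_cases hcc : c' = c
    · subst hcc; exact Or.inl ⟨_, Metric.isOpen_ball, Metric.mem_ball_self hr, h⟩
    · exact Or.inr ⟨_, Metric.isOpen_ball, Metric.mem_ball_self hr, c', hcc, h⟩
  have hsub : Ω ⊆ A := hΩc.isPreconnected.subset_left_of_subset_union hA hB hAB hcov
    ⟨x₀, hx₀, _, Metric.isOpen_ball, Metric.mem_ball_self hr₀, hc⟩
  refine ⟨c, (ae_restrict_iff' hΩ.measurableSet).2 (ae_iff.2 ?_)⟩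
  -- The exceptional null sets depend on the neighbourhood; second countability lets local nullity
  -- imply nullity.
  refine measure_null_of_locally_null _ fun x hx => ?_
  simp only [Set.mem_ofPred_eq, Classical.not_imp] at hx
  obtain ⟨U, hU, hxU, h⟩ := hsub hx.1
  refine ⟨_, inter_mem_nhdsWithin _ (hU.mem_nhds hxU), measure_mono_null ?_ (ae_iff.1 h)⟩
  rintro z ⟨hz, hzU⟩ hcon
  exact hz fun _ => hcon hzU

/-! ### The weak gradient is linear -/

/-- Representatives of `Lp` classes obey the vector space operations only almost everywhere; this
transfers weak gradients between them. -/
lemma IsWeakGrad.congr {Ω : Set (Vec d)} {u u' : Vec d → ℝ} {g g' : Vec d → Vec d}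
    (h : IsWeakGrad Ω u g) (hu' : LocallyIntegrableOn u' Ω) (hg' : LocallyIntegrableOn g' Ω)
    (hu : u =ᵐ[vol Ω] u') (hg : g =ᵐ[vol Ω] g') : IsWeakGrad Ω u' g' := by
  refine ⟨hu', hg', fun φ hφ v => ?_⟩
  have h1 := h.byParts φ hφ v
  rw [integral_congr_ae (g := fun x => u' x * fderiv ℝ φ x v)
      (by filter_upwards [hu] with x hx; rw [hx]),
    integral_congr_ae (f := fun x => φ x * ⟪g x, v⟫) (g := fun x => φ x * ⟪g' x, v⟫)
      (by filter_upwards [hg] with x hx; rw [hx])] at h1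
  exact h1

lemma locallyIntegrableOn_of_memLp {Ω : Set (Vec d)} {E : Type*} [NormedAddCommGroup E]
    {r : ℝ≥0∞} (hr : 1 ≤ r) {g : Vec d → E} (hg : MemLp g r (vol Ω)) : LocallyIntegrableOn g Ω :=
  locallyIntegrableOn_of_locallyIntegrable_restrict (hg.locallyIntegrable hr)

lemma IsTest.fderiv_apply {Ω : Set (Vec d)} {φ : Vec d → ℝ} (hφ : IsTest Ω φ) (v : Vec d) :
    IsTest Ω fun x => fderiv ℝ φ x v :=
  ⟨(hφ.smooth.fderiv_right (m := ∞) (by simp)).clm_apply contDiff_const,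
    hφ.compact.fderiv_apply ℝ v,
    (tsupport_fderiv_apply_subset ℝ v).trans hφ.subset⟩

lemma IsTest.memLp {Ω : Set (Vec d)} {φ : Vec d → ℝ} (hφ : IsTest Ω φ) (r : ℝ≥0∞) :
    MemLp φ r (vol Ω) :=
  (hφ.smooth.continuous.memLp_of_hasCompactSupport hφ.compact).restrict _

lemma IsTest.integrable_mul {Ω : Set (Vec d)} {φ : Vec d → ℝ} (hφ : IsTest Ω φ)
    {u : Vec d → ℝ} (hu : LocallyIntegrableOn u Ω) : Integrable (fun x => φ x * u x) (vol Ω) :=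
  (hφ.integrable_smul hu).restrict

lemma IsTest.integrable_mul_inner {Ω : Set (Vec d)} {φ : Vec d → ℝ} (hφ : IsTest Ω φ)
    {g : Vec d → Vec d} (hg : LocallyIntegrableOn g Ω) (v : Vec d) :
    Integrable (fun x => φ x * ⟪g x, v⟫) (vol Ω) := by
  have h := ((hφ.integrable_smul hg).inner_const (𝕜 := ℝ) v).restrict (s := Ω)
  simpa only [inner_smul_left, RCLike.conj_to_real] using h

lemma IsWeakGrad.add {Ω : Set (Vec d)} {u₁ u₂ : Vec d → ℝ} {g₁ g₂ : Vec d → Vec d}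
    (h₁ : IsWeakGrad Ω u₁ g₁) (h₂ : IsWeakGrad Ω u₂ g₂) : IsWeakGrad Ω (u₁ + u₂) (g₁ + g₂) := by
  refine ⟨h₁.locInt.add h₂.locInt, h₁.locInt_grad.add h₂.locInt_grad, fun φ hφ v => ?_⟩
  have e1 := (hφ.fderiv_apply v).integrable_mul h₁.locInt
  have e2 := (hφ.fderiv_apply v).integrable_mul h₂.locInt
  have e3 := integral_add (hφ.integrable_mul_inner h₁.locInt_grad v)
    (hφ.integrable_mul_inner h₂.locInt_grad v)
  simp only [Pi.add_apply, inner_add_left, mul_add, add_mul]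
  simp only [mul_comm (fderiv ℝ φ _ v)] at e1 e2
  rw [integral_add e1 e2, e3, h₁.byParts φ hφ v, h₂.byParts φ hφ v]
  ring

lemma IsWeakGrad.const_smul {Ω : Set (Vec d)} {u : Vec d → ℝ} {g : Vec d → Vec d}
    (h : IsWeakGrad Ω u g) (c : ℝ) : IsWeakGrad Ω (c • u) (c • g) := by
  refine ⟨h.locInt.smul c, h.locInt_grad.smul c, fun φ hφ v => ?_⟩
  simp only [Pi.smul_apply, smul_eq_mul, inner_smul_left, RCLike.conj_to_real, mul_assoc,
    mul_left_comm _ c, integral_const_mul, h.byParts φ hφ v]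
  ring

lemma isWeakGrad_const (Ω : Set (Vec d)) (c : ℝ) : IsWeakGrad Ω (fun _ => c) 0 := by
  refine ⟨(locallyIntegrable_const c).locallyIntegrableOn _,
    (locallyIntegrable_const 0).locallyIntegrableOn _, fun φ hφ v => ?_⟩
  have h1 := (hφ.fderiv_apply v).setIntegral_smul (fun _ => c)
  have h2 := integral_mul_fderiv_eq_neg_fderiv_mul_of_integrable (f := fun _ : Vec d => c)
    (g := φ) (v := v) (μ := volume) (by simp)
    ((hφ.fderiv_apply v).smooth.continuous.integrable_of_hasCompactSupport
      (hφ.fderiv_apply v).compact |>.const_mul c)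
    ((hφ.smooth.continuous.integrable_of_hasCompactSupport hφ.compact).const_mul c)
    (by simp) (fun x _ => hφ.smooth.differentiable (by simp) x)
  simp only [smul_eq_mul, mul_comm _ c] at h1
  rw [h1, h2]
  simp

/-- The coordinate function `x ↦ ⟪a, x⟫` has the constant weak gradient `a`. -/
lemma isWeakGrad_inner (Ω : Set (Vec d)) (a : Vec d) :
    IsWeakGrad Ω (fun x => ⟪a, x⟫) fun _ => a := by
  have hc : Continuous fun x : Vec d => ⟪a, x⟫ := by fun_prop
  refine ⟨hc.locallyIntegrable.locallyIntegrableOn _,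
    (locallyIntegrable_const a).locallyIntegrableOn _, fun φ hφ v => ?_⟩
  have hd : ∀ x v, fderiv ℝ (fun x : Vec d => ⟪a, x⟫) x v = ⟪a, v⟫ := fun x v => by
    rw [show (fun x : Vec d => ⟪a, x⟫) = innerSL ℝ a from rfl, ContinuousLinearMap.fderiv]
    rfl
  have hφd := hφ.fderiv_apply v
  have h1 := hφd.setIntegral_smul (fun x => ⟪a, x⟫)
  have h3 := hφ.setIntegral_smul (fun _ => ⟪a, v⟫)
  have h2 := integral_mul_fderiv_eq_neg_fderiv_mul_of_integrable (f := fun x : Vec d => ⟪a, x⟫)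
    (g := φ) (v := v) (μ := volume)
    (by
      simp only [hd]
      exact (hφ.smooth.continuous.integrable_of_hasCompactSupport hφ.compact).const_mul _)
    ((hc.mul hφd.smooth.continuous).integrable_of_hasCompactSupport hφd.compact.mul_left)
    ((hc.mul hφ.smooth.continuous).integrable_of_hasCompactSupport hφ.compact.mul_left)
    (fun x _ => (innerSL ℝ a).differentiableAt) (fun x _ => hφ.smooth.differentiable (by simp) x)
  simp only [hd] at h2
  simp only [smul_eq_mul] at h1 h3
  simp only [h3, mul_comm _ (fderiv ℝ φ _ v), h1]
  simp only [mul_comm (fderiv ℝ φ _ v), h2]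
  simp only [mul_comm]

lemma MemW1.isWeakGrad {Ω : Set (Vec d)} {r : ℝ≥0∞} {u : Vec d → ℝ} (hu : MemW1 r Ω u) :
    IsWeakGrad Ω u (weakGrad Ω u) := by
  have h : ∃ g, IsWeakGrad Ω u g := ⟨_, hu.2.choose_spec.1⟩
  rw [weakGrad, dif_pos h]
  exact h.choose_spec

lemma MemW1.memLp_weakGrad {Ω : Set (Vec d)} (hΩ : IsOpen Ω) {r : ℝ≥0∞} {u : Vec d → ℝ}
    (hu : MemW1 r Ω u) : MemLp (weakGrad Ω u) r (vol Ω) := by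
  obtain ⟨g, hg, hgr⟩ := hu.2
  exact hgr.ae_eq (hg.weakGrad_ae hΩ).symm

lemma MemW1.add {Ω : Set (Vec d)} {r : ℝ≥0∞} {u v : Vec d → ℝ}
    (hu : MemW1 r Ω u) (hv : MemW1 r Ω v) : MemW1 r Ω (u + v) := by
  obtain ⟨hu1, g, hg, hgr⟩ := hu
  obtain ⟨hv1, k, hk, hkr⟩ := hv
  exact ⟨hu1.add hv1, g + k, hg.add hk, hgr.add hkr⟩

lemma MemW1.const_smul {Ω : Set (Vec d)} {r : ℝ≥0∞} {u : Vec d → ℝ}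
    (hu : MemW1 r Ω u) (c : ℝ) : MemW1 r Ω (c • u) := by
  obtain ⟨hu1, g, hg, hgr⟩ := hu
  exact ⟨hu1.const_smul c, c • g, hg.const_smul c, hgr.const_smul c⟩

lemma MemW1.mono_exponent {Ω : Set (Vec d)} [IsFiniteMeasure (vol Ω)] {r s : ℝ≥0∞}
    {u : Vec d → ℝ} (hu : MemW1 r Ω u) (hsr : s ≤ r) : MemW1 s Ω u := by
  obtain ⟨hu1, g, hg, hgr⟩ := hu
  exact ⟨hu1.mono_exponent hsr, g, hg, hgr.mono_exponent hsr⟩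

/-- Row `i` of a matrix, as a continuous linear map. -/
def rowL (d : ℕ) (i : Fin d) : Mat d →L[ℝ] Vec d :=
  LinearMap.toContinuousLinearMap
    { toFun := fun M => WithLp.toLp 2 fun k => M (i, k)
      map_add' := fun _ _ => rfl
      map_smul' := fun _ _ => rfl }

@[simp] lemma rowL_apply (i k : Fin d) (M : Mat d) : rowL d i M k = M (i, k) := rfl

lemma rowL_weakJac (Ω : Set (Vec d)) (χ : Vec d → Vec d) (x : Vec d) (i : Fin d) :
    rowL d i (weakJac Ω χ x) = weakGrad Ω (fun z => χ z i) x := rfl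

lemma MemW1Vec.memLp {Ω : Set (Vec d)} {r : ℝ≥0∞} {χ : Vec d → Vec d} (hχ : MemW1Vec r Ω χ) :
    MemLp χ r (vol Ω) :=
  memLp_piLp_iff.2 fun i => (hχ i).1

lemma MemW1Vec.memLp_weakJac {Ω : Set (Vec d)} (hΩ : IsOpen Ω) {r : ℝ≥0∞} {χ : Vec d → Vec d}
    (hχ : MemW1Vec r Ω χ) : MemLp (weakJac Ω χ) r (vol Ω) :=
  memLp_piLp_iff.2 fun ik => memLp_piLp_iff.1 ((hχ ik.1).memLp_weakGrad hΩ) ik.2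

/-- A matrix field whose rows are weak gradients of the components of `χ` is the Jacobian. -/
lemma weakJac_ae {Ω : Set (Vec d)} (hΩ : IsOpen Ω) {χ : Vec d → Vec d} {G : Vec d → Mat d}
    (h : ∀ i, IsWeakGrad Ω (fun z => χ z i) fun x => rowL d i (G x)) :
    weakJac Ω χ =ᵐ[vol Ω] G := by
  filter_upwards [ae_all_iff.2 fun i => (h i).weakGrad_ae hΩ] with x hx
  ext ⟨i, k⟩
  have := congrArg (fun v : Vec d => v k) (hx i)
  exact this

lemma MemW1Vec.add {Ω : Set (Vec d)} {r : ℝ≥0∞} {χ ζ : Vec d → Vec d} (hχ : MemW1Vec r Ω χ)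
    (hζ : MemW1Vec r Ω ζ) : MemW1Vec r Ω (χ + ζ) := fun i => (hχ i).add (hζ i)

lemma MemW1Vec.const_smul {Ω : Set (Vec d)} {r : ℝ≥0∞} {χ : Vec d → Vec d}
    (hχ : MemW1Vec r Ω χ) (c : ℝ) : MemW1Vec r Ω (c • χ) := fun i => (hχ i).const_smul c

lemma weakJac_add_ae {Ω : Set (Vec d)} (hΩ : IsOpen Ω) {r : ℝ≥0∞} {χ ζ : Vec d → Vec d}
    (hχ : MemW1Vec r Ω χ) (hζ : MemW1Vec r Ω ζ) :
    weakJac Ω (χ + ζ) =ᵐ[vol Ω] weakJac Ω χ + weakJac Ω ζ :=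
  weakJac_ae hΩ fun i => (hχ i).isWeakGrad.add (hζ i).isWeakGrad

lemma weakJac_const_smul_ae {Ω : Set (Vec d)} (hΩ : IsOpen Ω) {r : ℝ≥0∞} {χ : Vec d → Vec d}
    (hχ : MemW1Vec r Ω χ) (c : ℝ) :
    weakJac Ω (c • χ) =ᵐ[vol Ω] c • weakJac Ω χ :=
  weakJac_ae hΩ fun i => (hχ i).isWeakGrad.const_smul c

/-! ### Uniformly convex minimization -/

/-- Clarkson's inequality for exponents `q ≥ 2` in an inner product space. -/
lemma clarkson_inner {E : Type*} [NormedAddCommGroup E] [InnerProductSpace ℝ E] {q : ℝ}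
    (hq : 2 ≤ q) (a b : E) :
    ‖(1 / 2 : ℝ) • (a + b)‖ ^ q + ‖(1 / 2 : ℝ) • (a - b)‖ ^ q ≤ (‖a‖ ^ q + ‖b‖ ^ q) / 2 := by
  have hq' : 1 ≤ q / 2 := by linarith
  have hpow : ∀ x : E, ‖x‖ ^ q = (‖x‖ ^ 2) ^ (q / 2) := fun x => by
    rw [← Real.rpow_natCast, ← Real.rpow_mul (norm_nonneg x)]
    congr 1
    push_cast
    ring
  -- With `s = q / 2 ≥ 1` applied to squared norms: superadditivity of `x ↦ x ^ s`, then the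
  -- parallelogram law, then convexity of `x ↦ x ^ s`.
  have h1 := Real.add_rpow_le_rpow_add (a := ‖(1 / 2 : ℝ) • (a + b)‖ ^ 2)
    (b := ‖(1 / 2 : ℝ) • (a - b)‖ ^ 2) (by positivity) (by positivity) hq'
  have h2 : ‖(1 / 2 : ℝ) • (a + b)‖ ^ 2 + ‖(1 / 2 : ℝ) • (a - b)‖ ^ 2
      = 1 / 2 * ‖a‖ ^ 2 + 1 / 2 * ‖b‖ ^ 2 := by
    have := parallelogram_law_with_norm ℝ a b
    simp only [norm_smul, mul_pow] at this ⊢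
    norm_num
    linarith
  have h3 := (convexOn_rpow hq').2 (Set.mem_Ici.2 (sq_nonneg ‖a‖)) (Set.mem_Ici.2 (sq_nonneg ‖b‖))
    (show (0 : ℝ) ≤ 1 / 2 by norm_num) (show (0 : ℝ) ≤ 1 / 2 by norm_num) (by norm_num)
  simp only [smul_eq_mul] at h3
  simp only [hpow]
  rw [h2] at h1
  linarith

lemma lpNorm_rpow {α E : Type*} [MeasurableSpace α] [NormedAddCommGroup E] {μ : Measure α}
    {q : ℝ} (hq : 0 < q) {f : α → E} (hf : AEStronglyMeasurable f μ) :
    lpNorm f (.ofReal q) μ ^ q = ∫ x, ‖f x‖ ^ q ∂μ := by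
  rw [lpNorm_eq_integral_norm_rpow_toReal (by simpa using hq) (by simp) hf,
    ENNReal.toReal_ofReal hq.le, ← Real.rpow_mul (integral_nonneg fun x => by positivity),
    inv_mul_cancel₀ hq.ne', Real.rpow_one]

lemma norm_Lp_eq_lpNorm {α E : Type*} [MeasurableSpace α] [NormedAddCommGroup E] {μ : Measure α}
    {r : ℝ≥0∞} (f : Lp E r μ) : ‖f‖ = lpNorm f r μ := by
  rw [Lp.norm_def, toReal_eLpNorm (Lp.aestronglyMeasurable f)]

lemma norm_Lp_rpow {α E : Type*} [MeasurableSpace α] [NormedAddCommGroup E] {μ : Measure α}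
    {q : ℝ} (hq : 0 < q) (f : Lp E (.ofReal q) μ) : ‖f‖ ^ q = ∫ x, ‖f x‖ ^ q ∂μ := by
  rw [norm_Lp_eq_lpNorm, lpNorm_rpow hq (Lp.aestronglyMeasurable f)]

lemma integrable_norm_rpow_ofReal {α E : Type*} [MeasurableSpace α] [NormedAddCommGroup E]
    {μ : Measure α} {q : ℝ} (hq : 0 < q) {f : α → E} (hf : MemLp f (.ofReal q) μ) :
    Integrable (fun x => ‖f x‖ ^ q) μ := by
  have := hf.integrable_norm_rpow (by simpa using hq) (by simp)
  rwa [ENNReal.toReal_ofReal hq.le] at this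

/-- Clarkson's inequality for exponents `q ≥ 2` in `L^q`. -/
lemma clarkson_Lp {α E : Type*} [MeasurableSpace α] [NormedAddCommGroup E]
    [InnerProductSpace ℝ E] {μ : Measure α} {q : ℝ} (hq : 2 ≤ q) (a b : Lp E (.ofReal q) μ) :
    ‖(1 / 2 : ℝ) • (a + b)‖ ^ q + ‖(1 / 2 : ℝ) • (a - b)‖ ^ q ≤ (‖a‖ ^ q + ‖b‖ ^ q) / 2 := by
  have hq0 : 0 < q := by linarith
  have hI := fun f : Lp E (.ofReal q) μ => integrable_norm_rpow_ofReal hq0 (Lp.memLp f)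
  simp only [norm_Lp_rpow hq0]
  rw [← integral_add (hI _) (hI _), ← integral_add (hI _) (hI _), ← integral_div]
  refine integral_mono_ae ((hI _).add (hI _)) (((hI _).add (hI _)).div_const 2) ?_
  filter_upwards [Lp.coeFn_smul (1 / 2 : ℝ) (a + b), Lp.coeFn_smul (1 / 2 : ℝ) (a - b),
    Lp.coeFn_add a b, Lp.coeFn_sub a b] with x h1 h2 h3 h4
  simp only [Pi.smul_apply] at h1 h2
  simp only [Pi.add_apply, h1, h2, h3, h4, Pi.sub_apply]
  exact clarkson_inner hq _ _

/-- In a Banach space satisfying Clarkson's inequality, `v ↦ ‖v‖ ^ q / q + L v` has a minimizer. -/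
theorem exists_minimizer {V : Type*} [NormedAddCommGroup V] [NormedSpace ℝ V] [CompleteSpace V]
    {p q : ℝ} (hpq : p.HolderConjugate q)
    (hV : ∀ a b : V, ‖(1 / 2 : ℝ) • (a + b)‖ ^ q + ‖(1 / 2 : ℝ) • (a - b)‖ ^ q
      ≤ (‖a‖ ^ q + ‖b‖ ^ q) / 2) (L : V →L[ℝ] ℝ) :
    ∃ v, ∀ w, ‖v‖ ^ q / q + L v ≤ ‖w‖ ^ q / q + L w := by
  have hq : 0 < q := hpq.symm.pos
  set Φ : V → ℝ := fun w => ‖w‖ ^ q / q + L w with hΦ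
  -- Young's inequality absorbs the linear term: `|L w| ≤ ‖L‖ ^ p / p + ‖w‖ ^ q / q`.
  have hbdd : BddBelow (Set.range Φ) := by
    refine ⟨-(‖L‖ ^ p / p), ?_⟩
    rintro _ ⟨w, rfl⟩
    have h1 := Real.young_inequality_of_nonneg (norm_nonneg L) (norm_nonneg w) hpq
    have h2 := L.le_opNorm w
    have h3 := neg_abs_le (L w)
    rw [Real.norm_eq_abs] at h2
    simp only [hΦ]
    linarith
  set m := ⨅ w, Φ w
  have hm : ∀ w, m ≤ Φ w := ciInf_le hbdd
  have hex : ∀ n : ℕ, ∃ w, Φ w < m + 1 / ((n : ℝ) + 1) := fun n =>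
    exists_lt_of_ciInf_lt (lt_add_of_pos_right m Nat.one_div_pos_of_nat)
  choose w hw using hex
  -- The linear part is exact at midpoints, so Clarkson controls the half-difference by the excess
  -- of the energies over the infimum. Almost-minimizers are therefore close to each other.
  have hmid : ∀ a b, ‖(1 / 2 : ℝ) • (a - b)‖ ^ q ≤ q * ((Φ a + Φ b) / 2 - m) := by
    intro a b
    have h1 := hm ((1 / 2 : ℝ) • (a + b))
    have h2 := hV a b
    simp only [hΦ, map_smul, map_add, smul_eq_mul] at h1 ⊢
    have e : q * ((‖a‖ ^ q / q + L a + (‖b‖ ^ q / q + L b)) / 2 - m)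
        = (‖a‖ ^ q + ‖b‖ ^ q) / 2 + q * (1 / 2 * (L a + L b) - m) := by
      field_simp
      ring
    have h3 := mul_le_mul_of_nonneg_left h1 hq.le
    rw [mul_add, mul_div_cancel₀ _ hq.ne'] at h3
    rw [e]
    linarith
  have hC : CauchySeq w := by
    refine Metric.cauchySeq_iff'.2 fun ε hε => ?_
    have hε' : 0 < (ε / 2) ^ q / q := by positivity
    obtain ⟨N, hN⟩ := exists_nat_one_div_lt hε'
    refine ⟨N, fun n hn => ?_⟩
    have h1 := hmid (w n) (w N)
    have h2 : 1 / ((n : ℝ) + 1) ≤ 1 / ((N : ℝ) + 1) := Nat.one_div_le_one_div hn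
    have h3 : (Φ (w n) + Φ (w N)) / 2 - m ≤ 1 / ((N : ℝ) + 1) := by
      linarith [hw n, hw N]
    have h4 : ‖(1 / 2 : ℝ) • (w n - w N)‖ ^ q < (ε / 2) ^ q := by
      refine (h1.trans (mul_le_mul_of_nonneg_left h3 hq.le)).trans_lt ?_
      rwa [lt_div_iff₀ hq, mul_comm] at hN
    have h5 := (Real.rpow_lt_rpow_iff (norm_nonneg _) (by positivity) hq).1 h4
    rw [norm_smul, Real.norm_of_nonneg (by norm_num)] at h5
    rw [dist_eq_norm]
    linarith
  obtain ⟨v, hv⟩ := cauchySeq_tendsto_of_complete hC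
  have hcont : Continuous Φ :=
    ((continuous_norm.rpow_const fun _ => Or.inr hq.le).div_const q).add L.continuous
  refine ⟨v, fun z => le_trans ?_ (hm z)⟩
  have hlim : Tendsto (fun n : ℕ => m + 1 / ((n : ℝ) + 1)) atTop (𝓝 m) := by
    simpa using tendsto_const_nhds.add (tendsto_one_div_add_atTop_nhds_zero_nat (𝕜 := ℝ))
  exact le_of_tendsto_of_tendsto' ((hcont.tendsto v).comp hv) hlim fun n => (hw n).le

/-! ### Factoring a functional through a surjection -/

/-- A bounded functional that vanishes on the kernel of a bounded surjection between Banach spaces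
factors through it. -/
theorem exists_clm_factor {W V : Type*} [NormedAddCommGroup W] [NormedSpace ℝ W] [CompleteSpace W]
    [NormedAddCommGroup V] [NormedSpace ℝ V] [CompleteSpace V] (A : W →L[ℝ] V)
    (hA : Function.Surjective A) (l : W →L[ℝ] ℝ) (hl : ∀ x, A x = 0 → l x = 0) :
    ∃ L : V →L[ℝ] ℝ, ∀ x, L (A x) = l x := by
  -- The open mapping theorem gives preimages with norm control. Their choice `s` need not be
  -- linear, but `l` is constant on the fibres of `A`, so `l ∘ s` is linear and bounded.
  obtain ⟨C, -, hC⟩ := A.exists_preimage_norm_le hA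
  choose s hs hsC using hC
  have key : ∀ x y, A x = A y → l x = l y := fun x y h => by
    rw [← sub_eq_zero, ← map_sub]
    exact hl _ (by rw [map_sub, h, sub_self])
  refine ⟨LinearMap.mkContinuous
    { toFun := fun v => l (s v)
      map_add' := fun v v' => by rw [← map_add]; exact key _ _ (by simp [hs])
      map_smul' := fun c v => by
        rw [RingHom.id_apply, ← map_smul]; exact key _ _ (by simp [hs]) } (‖l‖ * C) fun v => ?_,
    fun x => key _ _ (hs _)⟩
  calc ‖l (s v)‖ ≤ ‖l‖ * ‖s v‖ := l.le_opNorm _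
    _ ≤ ‖l‖ * (C * ‖v‖) := by gcongr; exact hsC v
    _ = ‖l‖ * C * ‖v‖ := by ring

/-! ### The duality pairing of `L^p` and `L^q` -/

lemma integrable_inner_of_memLp {α E : Type*} [MeasurableSpace α] [NormedAddCommGroup E]
    [InnerProductSpace ℝ E] {μ : Measure α} {p q : ℝ} (hpq : p.HolderConjugate q) {f g : α → E}
    (hf : MemLp f (.ofReal p) μ) (hg : MemLp g (.ofReal q) μ) :
    Integrable (fun x => ⟪f x, g x⟫) μ := by
  have := hpq.ennrealOfReal
  exact memLp_one_iff_integrable.1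
    (ContinuousLinearMap.memLp_of_bilin (𝕜 := ℝ) 1 (innerSL ℝ (E := E)) hf hg)

/-- Turns integral identities against an `L^p` field into closed conditions on `L^q`, and supplies
the linear part of the energy. -/
lemma exists_pairing {α E : Type*} [MeasurableSpace α] [NormedAddCommGroup E]
    [InnerProductSpace ℝ E] {μ : Measure α} {p q : ℝ} (hpq : p.HolderConjugate q)
    [Fact (1 ≤ ENNReal.ofReal q)] {h : α → E} (hh : MemLp h (.ofReal p) μ) :
    ∃ P : Lp E (.ofReal q) μ →L[ℝ] ℝ, ∀ g, P g = ∫ x, ⟪h x, g x⟫ ∂μ := by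
  have := hpq.ennrealOfReal
  have : Fact (1 ≤ ENNReal.ofReal p) := ⟨ENNReal.HolderConjugate.one_le _ (.ofReal q)⟩
  refine ⟨ContinuousLinearMap.lpPairing (𝕜 := ℝ) μ (.ofReal p) (.ofReal q)
    (innerSL ℝ (E := E)) (hh.toLp h), fun g => ?_⟩
  rw [ContinuousLinearMap.lpPairing_eq_integral]
  refine integral_congr_ae ?_
  filter_upwards [hh.coeFn_toLp] with x hx
  rw [hx]
  rfl

lemma one_le_ofReal_of_holderConjugate {p q : ℝ} (hpq : p.HolderConjugate q) :
    1 ≤ ENNReal.ofReal q := by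
  simpa using ENNReal.ofReal_le_ofReal hpq.symm.lt.le

/-! ### The Sobolev space as a closed subspace of a product of `L^q` spaces -/

/-- The pairs `(χ, G) ∈ L^r × L^r` for which the rows of `G` are weak gradients of the components of
`χ`. -/
def sobolevGraph (Ω : Set (Vec d)) (r : ℝ≥0∞) [hr : Fact (1 ≤ r)] :
    Submodule ℝ (Lp (Vec d) r (vol Ω) × Lp (Mat d) r (vol Ω)) where
  carrier := {z | ∀ i, IsWeakGrad Ω (fun x => z.1 x i) fun x => rowL d i (z.2 x)}
  zero_mem' i := by
    refine (isWeakGrad_const Ω 0).congr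
      (locallyIntegrableOn_of_memLp hr.out ((Lp.memLp _).eval_piLp i))
      (locallyIntegrableOn_of_memLp hr.out ((rowL d i).comp_memLp' (Lp.memLp _))) ?_ ?_
    · filter_upwards [Lp.coeFn_zero (Vec d) r (vol Ω)] with x hx
      simp only [Prod.fst_zero, hx, Pi.zero_apply, PiLp.zero_apply]
    · filter_upwards [Lp.coeFn_zero (Mat d) r (vol Ω)] with x hx
      simp only [Prod.snd_zero, hx, Pi.zero_apply, map_zero]
  add_mem' {a b} ha hb i := by
    refine ((ha i).add (hb i)).congr
      (locallyIntegrableOn_of_memLp hr.out ((Lp.memLp _).eval_piLp i))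
      (locallyIntegrableOn_of_memLp hr.out ((rowL d i).comp_memLp' (Lp.memLp _))) ?_ ?_
    · filter_upwards [Lp.coeFn_add a.1 b.1] with x hx
      simp only [Prod.fst_add, hx, Pi.add_apply, PiLp.add_apply]
    · filter_upwards [Lp.coeFn_add a.2 b.2] with x hx
      simp only [Prod.snd_add, hx, Pi.add_apply, map_add]
  smul_mem' c a ha i := by
    refine ((ha i).const_smul c).congr
      (locallyIntegrableOn_of_memLp hr.out ((Lp.memLp _).eval_piLp i))
      (locallyIntegrableOn_of_memLp hr.out ((rowL d i).comp_memLp' (Lp.memLp _))) ?_ ?_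
    · filter_upwards [Lp.coeFn_smul c a.1] with x hx
      simp [hx]
    · filter_upwards [Lp.coeFn_smul c a.2] with x hx
      simp [hx]

section Graph

variable {Ω : Set (Vec d)} {r : ℝ≥0∞} [hr : Fact (1 ≤ r)]

lemma memW1Vec_of_mem_sobolevGraph {z : Lp (Vec d) r (vol Ω) × Lp (Mat d) r (vol Ω)}
    (hz : z ∈ sobolevGraph Ω r) : MemW1Vec r Ω z.1 := fun i =>
  ⟨(Lp.memLp _).eval_piLp i, _, hz i, (rowL d i).comp_memLp' (Lp.memLp _)⟩

lemma toLp_mem_sobolevGraph (hΩ : IsOpen Ω) {χ : Vec d → Vec d} (hχ : MemW1Vec r Ω χ) :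
    (hχ.memLp.toLp χ, (hχ.memLp_weakJac hΩ).toLp (weakJac Ω χ)) ∈ sobolevGraph Ω r := by
  intro i
  refine (hχ i).isWeakGrad.congr
    (locallyIntegrableOn_of_memLp hr.out ((Lp.memLp _).eval_piLp i))
    (locallyIntegrableOn_of_memLp hr.out ((rowL d i).comp_memLp' (Lp.memLp _))) ?_ ?_
  · filter_upwards [hχ.memLp.coeFn_toLp] with x hx
    rw [hx]
  · filter_upwards [(hχ.memLp_weakJac hΩ).coeFn_toLp] with x hx
    rw [hx, rowL_weakJac]

end Graph

/-- For each fixed test function and direction, integration by parts is the vanishing of a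
continuous functional of the pair, so it survives limits in `L^q`. -/
lemma isClosed_sobolevGraph (Ω : Set (Vec d)) {p q : ℝ} (hpq : p.HolderConjugate q)
    [hq : Fact (1 ≤ ENNReal.ofReal q)] :
    IsClosed (sobolevGraph Ω (.ofReal q) : Set (Lp (Vec d) (.ofReal q) (vol Ω) ×
      Lp (Mat d) (.ofReal q) (vol Ω))) := by
  refine IsSeqClosed.isClosed fun z z₀ hz hlim i => ?_
  refine ⟨locallyIntegrableOn_of_memLp hq.out ((Lp.memLp _).eval_piLp i),
    locallyIntegrableOn_of_memLp hq.out ((rowL d i).comp_memLp' (Lp.memLp _)), fun φ hφ v => ?_⟩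
  obtain ⟨P, hP⟩ := exists_pairing hpq ((ContinuousLinearMap.toSpanSingleton ℝ
    (EuclideanSpace.single i (1 : ℝ))).comp_memLp' ((hφ.fderiv_apply v).memLp (Ω := Ω) (.ofReal p)))
  obtain ⟨Q, hQ⟩ := exists_pairing hpq ((ContinuousLinearMap.toSpanSingleton ℝ
    ((rowL d i).adjoint v)).comp_memLp' (hφ.memLp (.ofReal p)))
  have hP' : ∀ g, P g = ∫ x in Ω, g x i * fderiv ℝ φ x v := fun g => by
    rw [hP]
    refine integral_congr_ae (.of_forall fun x => ?_)
    simp [inner_smul_left, EuclideanSpace.inner_single_left, mul_comm]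
  have hQ' : ∀ g, Q g = ∫ x in Ω, φ x * ⟪rowL d i (g x), v⟫ := fun g => by
    rw [hQ]
    refine integral_congr_ae (.of_forall fun x => ?_)
    simp [inner_smul_left, ContinuousLinearMap.adjoint_inner_left, real_inner_comm]
  have h1 : Tendsto (fun n => P (z n).1 + Q (z n).2) atTop (𝓝 (P z₀.1 + Q z₀.2)) :=
    ((P.continuous.comp continuous_fst).add (Q.continuous.comp continuous_snd)).tendsto z₀
      |>.comp hlim
  have h2 : ∀ n, P (z n).1 + Q (z n).2 = 0 := fun n => by
    rw [hP', hQ', (hz n i).byParts φ hφ v]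
    ring
  simp only [h2] at h1
  have h3 := tendsto_nhds_unique tendsto_const_nhds h1
  rw [hP', hQ'] at h3
  linarith

/-! ### The space of Jacobians and its closedness -/

/-- The Jacobians of the fields in `W^{1,r}(Ω; ℝ^d)`. -/
def jacobians (Ω : Set (Vec d)) (r : ℝ≥0∞) [Fact (1 ≤ r)] :
    Submodule ℝ (Lp (Mat d) r (vol Ω)) :=
  (sobolevGraph Ω r).map (LinearMap.snd ℝ _ _)

lemma two_le_of_holderConjugate {p q : ℝ} (hpq : p.HolderConjugate q) (hp2 : p ≤ 2) : 2 ≤ q := by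
  have h1 := hpq.sub_one_mul_conj
  have h2 := hpq.lt
  nlinarith

/-- The Helmholtz decomposition characterizes Jacobians by orthogonality. -/
lemma mem_jacobians_iff {Ω : Set (Vec d)} (hΩ : IsOpen Ω) [IsFiniteMeasure (vol Ω)]
    {p q : ℝ} (hpq : p.HolderConjugate q) (hp2 : p ≤ 2) (hH : HasHelmholtz p q Ω)
    [hq : Fact (1 ≤ ENNReal.ofReal q)] (G : Lp (Mat d) (.ofReal q) (vol Ω)) :
    G ∈ jacobians Ω (.ofReal q) ↔
      ∀ i w, MemSolenoidal p q Ω w → ∫ x in Ω, ⟪w x, rowL d i (G x)⟫ = 0 := by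
  have hle : ENNReal.ofReal p ≤ ENNReal.ofReal q :=
    ENNReal.ofReal_le_ofReal (hp2.trans (two_le_of_holderConjugate hpq hp2))
  constructor
  · rintro ⟨z, hz, rfl⟩ i w hw
    have hχ := memW1Vec_of_mem_sobolevGraph hz
    rw [← hw.traceFree _ ((hχ i).mono_exponent hle)]
    refine integral_congr_ae ?_
    filter_upwards [(hz i).weakGrad_ae hΩ] with x hx
    rw [hx]
    rfl
  · intro h
    choose ϑ w hϑ hw hsum using fun i =>
      hH.sum (fun x => rowL d i (G x)) ((rowL d i).comp_memLp' (Lp.memLp G))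
    -- The solenoidal part is tested with itself: it is orthogonal to the row by hypothesis and to
    -- the gradient part by its vanishing trace, so `∫ |w i|^2 = 0`. The pairing makes sense because
    -- `p ≤ q` on a finite measure space.
    have hw0 : ∀ i, w i =ᵐ[vol Ω] 0 := by
      intro i
      have hwp := (hw i).memLp.mono_exponent hle
      have e1 := integrable_inner_of_memLp hpq hwp ((hϑ i).memLp_weakGrad hΩ)
      have e2 := integrable_inner_of_memLp hpq hwp (hw i).memLp
      have e3 := h i (w i) (hw i)
      rw [integral_congr_ae (g := fun x => ⟪w i x, weakGrad Ω (ϑ i) x⟫ + ⟪w i x, w i x⟫)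
          (by filter_upwards [hsum i] with x hx; rw [hx, inner_add_right]), integral_add e1 e2,
        (hw i).traceFree _ ((hϑ i).mono_exponent hle), zero_add,
        integral_eq_zero_iff_of_nonneg (fun x => real_inner_self_nonneg) e2] at e3
      filter_upwards [e3] with x hx
      exact inner_self_eq_zero.1 hx
    have hχ : MemW1Vec (.ofReal q) Ω fun x => WithLp.toLp 2 fun i => ϑ i x := fun i => hϑ i
    refine ⟨_, toLp_mem_sobolevGraph hΩ hχ, Lp.ext ?_⟩
    refine (MemLp.coeFn_toLp (hχ.memLp_weakJac hΩ)).trans ?_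
    filter_upwards [ae_all_iff.2 hw0, ae_all_iff.2 hsum] with x h1 h2
    ext ⟨i, k⟩
    have := congrArg (fun v : Vec d => v k) (h2 i)
    simp only [h1, Pi.zero_apply, add_zero, rowL_apply] at this
    rw [this]
    rfl

/-- By `mem_jacobians_iff` the space is an intersection of kernels of pairings with solenoidal
fields, which are continuous on `L^q` since these fields also lie in `L^p`. -/
lemma isClosed_jacobians {Ω : Set (Vec d)} (hΩ : IsOpen Ω) [IsFiniteMeasure (vol Ω)]
    {p q : ℝ} (hpq : p.HolderConjugate q) (hp2 : p ≤ 2) (hH : HasHelmholtz p q Ω)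
    [hq : Fact (1 ≤ ENNReal.ofReal q)] :
    IsClosed (jacobians Ω (.ofReal q) : Set (Lp (Mat d) (.ofReal q) (vol Ω))) := by
  have hle : ENNReal.ofReal p ≤ ENNReal.ofReal q :=
    ENNReal.ofReal_le_ofReal (hp2.trans (two_le_of_holderConjugate hpq hp2))
  refine IsSeqClosed.isClosed fun G G₀ hG hlim => ?_
  refine (mem_jacobians_iff hΩ hpq hp2 hH G₀).2 fun i w hw => ?_
  obtain ⟨P, hP⟩ := exists_pairing hpq
    ((rowL d i).adjoint.comp_memLp' (hw.memLp.mono_exponent hle))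
  have hP' : ∀ g, P g = ∫ x in Ω, ⟪w x, rowL d i (g x)⟫ := fun g => by
    rw [hP]
    refine integral_congr_ae (.of_forall fun x => ?_)
    simp [ContinuousLinearMap.adjoint_inner_left]
  have h1 := (P.continuous.tendsto G₀).comp hlim
  have h2 : ∀ n, P (G n) = 0 := fun n => by
    rw [hP', (mem_jacobians_iff hΩ hpq hp2 hH (G n)).1 (hG n) i w hw]
  rw [← hP']
  refine tendsto_nhds_unique h1 ?_
  simp [Function.comp_def, h2]

/-- Existence of a minimizer of `χ ↦ ‖∇χ‖^q / q + (A, ∇χ) + (b, χ)` over `W^{1,q}(Ω; ℝ^d)`. -/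
theorem exists_energy_minimizer {Ω : Set (Vec d)} (hΩ : IsOpen Ω) (hΩc : IsConnected Ω)
    [IsFiniteMeasure (vol Ω)] {p q : ℝ} (hpq : p.HolderConjugate q) (hp2 : p ≤ 2)
    (hH : HasHelmholtz p q Ω) {A : Vec d → Mat d} (hA : MemLp A (.ofReal p) (vol Ω))
    {b : Vec d → Vec d} (hb : MemLp b (.ofReal p) (vol Ω))
    (hb0 : ∀ e : Vec d, ∫ x in Ω, ⟪b x, e⟫ = 0) :
    ∃ θ, MemW1Vec (.ofReal q) Ω θ ∧ ∀ χ, MemW1Vec (.ofReal q) Ω χ →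
      (∫ x in Ω, ‖weakJac Ω θ x‖ ^ q) / q
          + ((∫ x in Ω, ⟪A x, weakJac Ω θ x⟫) + ∫ x in Ω, ⟪b x, θ x⟫)
        ≤ (∫ x in Ω, ‖weakJac Ω χ x‖ ^ q) / q
          + ((∫ x in Ω, ⟪A x, weakJac Ω χ x⟫) + ∫ x in Ω, ⟪b x, χ x⟫) := by
  have hq : Fact (1 ≤ ENNReal.ofReal q) := ⟨one_le_ofReal_of_holderConjugate hpq⟩
  have hq0 : 0 < q := hpq.symm.pos
  have : CompleteSpace (sobolevGraph Ω (.ofReal q)) :=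
    (isClosed_sobolevGraph Ω hpq).completeSpace_coe
  have : CompleteSpace (jacobians Ω (.ofReal q)) :=
    (isClosed_jacobians hΩ hpq hp2 hH).completeSpace_coe
  obtain ⟨P, hP⟩ := exists_pairing hpq hA
  obtain ⟨Q, hQ⟩ := exists_pairing hpq hb
  -- The gradient operator as a bounded surjection between Banach spaces; closedness of its range is
  -- what the Helmholtz decomposition provides.
  let D : sobolevGraph Ω (.ofReal q) →L[ℝ] jacobians Ω (.ofReal q) :=
    ((ContinuousLinearMap.snd ℝ _ _).comp (sobolevGraph Ω (.ofReal q)).subtypeL).codRestrict _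
      fun z => ⟨z, z.2, rfl⟩
  have hD : Function.Surjective D := by
    rintro ⟨_, z, hz, rfl⟩
    exact ⟨⟨z, hz⟩, rfl⟩
  let l : sobolevGraph Ω (.ofReal q) →L[ℝ] ℝ :=
    (P.comp (ContinuousLinearMap.snd ℝ _ _) + Q.comp (ContinuousLinearMap.fst ℝ _ _)).comp
      (sobolevGraph Ω (.ofReal q)).subtypeL
  have hl : ∀ z, l z = P z.1.2 + Q z.1.1 := fun z => rfl
  -- The kernel of `D` consists of the constant fields, because `Ω` is connected, and `hb0` says
  -- that the load vanishes on these.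
  obtain ⟨L, hL⟩ := exists_clm_factor D hD l (by
    rintro ⟨⟨χ, G⟩, hz⟩ h0
    have hG : G = 0 := congrArg Subtype.val h0
    subst hG
    have hconst : ∀ i, ∃ c, (fun x => χ x i) =ᵐ[vol Ω] fun _ => c := fun i => by
      refine IsWeakGrad.exists_const hΩ hΩc ((hz i).congr (hz i).locInt
        ((locallyIntegrable_const 0).locallyIntegrableOn _) .rfl ?_)
      filter_upwards [Lp.coeFn_zero (Mat d) (.ofReal q) (vol Ω)] with x hx
      simp only [hx, Pi.zero_apply, map_zero]
    choose c hc using hconst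
    rw [hl]
    simp only [map_zero, zero_add]
    rw [hQ, ← hb0 (WithLp.toLp 2 c)]
    refine integral_congr_ae ?_
    filter_upwards [ae_all_iff.2 hc] with x hx
    rw [show χ x = WithLp.toLp 2 c from by ext i; exact hx i])
  obtain ⟨v, hv⟩ := exists_minimizer hpq (V := jacobians Ω (.ofReal q))
    (fun a b => clarkson_Lp (two_le_of_holderConjugate hpq hp2) a.1 b.1) L
  obtain ⟨z, rfl⟩ := hD v
  have hval : ∀ z : sobolevGraph Ω (.ofReal q), ‖D z‖ ^ q / q + L (D z)
      = (∫ x in Ω, ‖weakJac Ω z.1.1 x‖ ^ q) / q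
        + ((∫ x in Ω, ⟪A x, weakJac Ω z.1.1 x⟫) + ∫ x in Ω, ⟪b x, z.1.1 x⟫) := fun z => by
    have h1 := weakJac_ae hΩ z.2
    rw [hL, hl, hP, hQ, show ‖D z‖ = ‖z.1.2‖ from rfl, norm_Lp_rpow hq0]
    refine congrArg₂ (· + ·) (congrArg (· / q) ?_) (congrArg (· + _) ?_)
    · refine integral_congr_ae ?_
      filter_upwards [h1] with x hx
      rw [hx]
    · refine integral_congr_ae ?_
      filter_upwards [h1] with x hx
      rw [hx]
  refine ⟨z.1.1, memW1Vec_of_mem_sobolevGraph z.2, fun χ hχ => ?_⟩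
  have h1 := hv (D ⟨_, toLp_mem_sobolevGraph hΩ hχ⟩)
  rw [hval z, hL, hl, hP, hQ] at h1
  refine h1.trans (le_of_eq ?_)
  have e1 := (hχ.memLp_weakJac hΩ).coeFn_toLp
  rw [show ‖D ⟨_, toLp_mem_sobolevGraph hΩ hχ⟩‖
    = ‖(hχ.memLp_weakJac hΩ).toLp (weakJac Ω χ)‖ from rfl, norm_Lp_rpow hq0]
  refine congrArg₂ (· + ·) (congrArg (· / q) ?_) (congrArg₂ (· + ·) ?_ ?_)
  · refine integral_congr_ae ?_
    filter_upwards [e1] with x hx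
    rw [hx]
  · refine integral_congr_ae ?_
    filter_upwards [e1] with x hx
    rw [hx]
  · refine integral_congr_ae ?_
    filter_upwards [hχ.memLp.coeFn_toLp] with x hx
    rw [hx]

/-! ### The first-order condition -/

lemma hasDerivAt_norm_rpow_line {E : Type*} [NormedAddCommGroup E] [InnerProductSpace ℝ E] {q : ℝ}
    (hq : 1 < q) (a b : E) (t : ℝ) :
    HasDerivAt (fun s : ℝ => ‖a + s • b‖ ^ q)
      (q * (‖a + t • b‖ ^ (q - 2) * ⟪a + t • b, b⟫)) t := by
  have h1 : HasDerivAt (fun s : ℝ => a + s • b) b t := by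
    simpa using ((hasDerivAt_id t).smul_const b).const_add a
  have h2 := (hasFDerivAt_norm_rpow (a + t • b) hq).comp_hasDerivAt t h1
  refine h2.congr_deriv ?_
  rw [smul_apply, innerSL_apply_apply, smul_eq_mul, mul_assoc]

lemma rpow_sub_two_mul_self {q : ℝ} (hq : 1 < q) {a : ℝ} (ha : 0 ≤ a) :
    a ^ (q - 2) * a = a ^ (q - 1) := by
  rcases ha.eq_or_lt with rfl | h
  · rw [mul_zero, Real.zero_rpow (by linarith)]
  · rw [← Real.rpow_add_one h.ne']
    congr 1
    ring

/-- The derivative of `t ↦ ‖g + t h‖^q / q` at `0`. -/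
lemma hasDerivAt_integral_norm_rpow {α E : Type*} [MeasurableSpace α] [NormedAddCommGroup E]
    [InnerProductSpace ℝ E] {μ : Measure α} {q : ℝ} (hq : 1 < q) {g h : α → E}
    (hg : MemLp g (.ofReal q) μ) (hh : MemLp h (.ofReal q) μ) :
    HasDerivAt (fun t : ℝ => (∫ x, ‖g x + t • h x‖ ^ q ∂μ) / q)
      (∫ x, ‖g x‖ ^ (q - 2) * ⟪g x, h x⟫ ∂μ) 0 := by
  have hq0 : 0 < q := by linarith
  have hm : ∀ t : ℝ, AEStronglyMeasurable (fun x => g x + t • h x) μ := fun t =>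
    hg.aestronglyMeasurable.add (hh.aestronglyMeasurable.const_smul t)
  -- For `|t| < 1` the derivative is at most `q ‖g + t h‖^{q-1} ‖h‖ ≤ q (‖g‖ + ‖h‖)^q`, which is
  -- integrable and independent of `t`.
  have key := hasDerivAt_integral_of_dominated_loc_of_deriv_le (μ := μ)
    (F := fun t x => ‖g x + t • h x‖ ^ q)
    (F' := fun t x => q * (‖g x + t • h x‖ ^ (q - 2) * ⟪g x + t • h x, h x⟫))
    (bound := fun x => q * (‖g x‖ + ‖h x‖) ^ q) (x₀ := (0 : ℝ))
    (Metric.ball_mem_nhds 0 one_pos)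
    (.of_forall fun t => ((hm t).norm.aemeasurable.pow_const q).aestronglyMeasurable)
    (by simpa using integrable_norm_rpow_ofReal hq0 hg)
    (by
      refine AEStronglyMeasurable.const_mul ?_ q
      exact ((hm 0).norm.aemeasurable.pow_const _).aestronglyMeasurable.mul
        ((hm 0).inner hh.aestronglyMeasurable))
    (.of_forall fun x t ht => by
      have ht' : |t| ≤ 1 := by
        have := Metric.mem_ball.1 ht
        rw [Real.dist_eq, sub_zero] at this
        exact this.le
      have h1 : ‖g x + t • h x‖ ≤ ‖g x‖ + ‖h x‖ := by
        refine (norm_add_le _ _).trans ?_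
        rw [norm_smul, Real.norm_eq_abs]
        have := mul_le_mul_of_nonneg_right ht' (norm_nonneg (h x))
        linarith
      rw [norm_mul, Real.norm_of_nonneg hq0.le, norm_mul, Real.norm_of_nonneg (by positivity)]
      refine mul_le_mul_of_nonneg_left ?_ hq0.le
      calc ‖g x + t • h x‖ ^ (q - 2) * ‖⟪g x + t • h x, h x⟫‖
          ≤ ‖g x + t • h x‖ ^ (q - 2) * (‖g x + t • h x‖ * ‖h x‖) := by
            gcongr; exact norm_inner_le_norm _ _
        _ = ‖g x + t • h x‖ ^ (q - 1) * ‖h x‖ := by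
            rw [← mul_assoc, rpow_sub_two_mul_self hq (norm_nonneg _)]
        _ ≤ (‖g x‖ + ‖h x‖) ^ (q - 1) * (‖g x‖ + ‖h x‖) := by
            have := norm_nonneg (g x)
            gcongr; linarith
        _ = (‖g x‖ + ‖h x‖) ^ q := by
            rw [← Real.rpow_add_one' (by positivity) (by linarith)]
            congr 1
            ring)
    (by
      refine Integrable.const_mul ?_ q
      have := integrable_norm_rpow_ofReal hq0 (hg.norm.add hh.norm)
      refine this.congr (.of_forall fun x => ?_)
      simp only [Pi.add_apply]
      rw [Real.norm_of_nonneg (by positivity)])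
    (.of_forall fun x t _ => hasDerivAt_norm_rpow_line hq _ _ t)
  refine (key.2.div_const q).congr_deriv ?_
  simp only [zero_smul, add_zero, integral_const_mul]
  rw [mul_div_cancel_left₀ _ hq0.ne']

/-- The Euler–Lagrange equation. -/
lemma integral_norm_rpow_inner_eq {α E : Type*} [MeasurableSpace α] [NormedAddCommGroup E]
    [InnerProductSpace ℝ E] {μ : Measure α} {q : ℝ} (hq : 1 < q) {g h : α → E}
    (hg : MemLp g (.ofReal q) μ) (hh : MemLp h (.ofReal q) μ) {c : ℝ}
    (hmin : ∀ t : ℝ, (∫ x, ‖g x‖ ^ q ∂μ) / q ≤ (∫ x, ‖g x + t • h x‖ ^ q ∂μ) / q + t * c) :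
    (∫ x, ‖g x‖ ^ (q - 2) * ⟪g x, h x⟫ ∂μ) + c = 0 := by
  have h1 := (hasDerivAt_integral_norm_rpow hq hg hh).add ((hasDerivAt_id (0 : ℝ)).mul_const c)
  have h2 : IsLocalMin (fun t : ℝ => (∫ x, ‖g x + t • h x‖ ^ q ∂μ) / q + t * c) 0 :=
    .of_forall fun t => by simpa using hmin t
  simpa using h2.hasDerivAt_eq_zero h1

/-! ### The duality map `v ↦ ‖v‖^(r - 2) v` -/

section Duality

variable {E : Type*} [NormedAddCommGroup E] [InnerProductSpace ℝ E] {p q : ℝ}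

lemma norm_rpow_sub_two_smul (hq : 1 < q) (v : E) : ‖‖v‖ ^ (q - 2) • v‖ = ‖v‖ ^ (q - 1) := by
  rw [norm_smul, Real.norm_of_nonneg (by positivity), rpow_sub_two_mul_self hq (norm_nonneg v)]

/-- The exponents cancel since `(q - 1) (p - 2) + (q - 2) = p q - p - q = 0`. This is what makes the
primal and dual optimality conditions equivalent. -/
lemma duality_map_leftInverse (hpq : p.HolderConjugate q) (v : E) :
    ‖‖v‖ ^ (q - 2) • v‖ ^ (p - 2) • (‖v‖ ^ (q - 2) • v) = v := by
  rcases eq_or_ne v 0 with rfl | hv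
  · simp
  · have hv' : 0 < ‖v‖ := norm_pos_iff.2 hv
    have h1 := hpq.sub_one_mul_conj
    have h2 := hpq.mul_eq_add
    rw [norm_rpow_sub_two_smul hpq.symm.lt, smul_smul, ← Real.rpow_mul hv'.le,
      ← Real.rpow_add hv', show (q - 1) * (p - 2) + (q - 2) = 0 by linarith,
      Real.rpow_zero, one_smul]

lemma norm_duality_map_rpow (hpq : p.HolderConjugate q) (v : E) :
    ‖‖v‖ ^ (p - 2) • v‖ ^ q = ‖v‖ ^ p := by
  rw [norm_rpow_sub_two_smul hpq.lt, ← Real.rpow_mul (norm_nonneg v), hpq.sub_one_mul_conj]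

lemma inner_duality_map (hp : 1 < p) (v : E) : ⟪v, ‖v‖ ^ (p - 2) • v⟫ = ‖v‖ ^ p := by
  rw [real_inner_smul_right, real_inner_self_eq_norm_sq, sq, ← mul_assoc,
    rpow_sub_two_mul_self hp (norm_nonneg v),
    ← Real.rpow_add_one' (norm_nonneg v) (by linarith)]
  congr 1
  ring

lemma memLp_duality_map {α : Type*} [MeasurableSpace α] {μ : Measure α}
    (hpq : p.HolderConjugate q) {g : α → E} (hg : MemLp g (.ofReal p) μ) :
    MemLp (fun x => ‖g x‖ ^ (p - 2) • g x) (.ofReal q) μ := by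
  have hm : AEStronglyMeasurable (fun x => ‖g x‖ ^ (p - 2) • g x) μ :=
    (hg.1.norm.aemeasurable.pow_const _).aestronglyMeasurable.smul hg.1
  refine (integrable_norm_rpow_iff hm (by simpa using hpq.symm.pos) (by simp)).1 ?_
  rw [ENNReal.toReal_ofReal hpq.symm.nonneg]
  simpa only [norm_duality_map_rpow hpq] using integrable_norm_rpow_ofReal hpq.pos hg

end Duality

/-- Hölder's inequality for the inner product. -/
lemma abs_integral_inner_le {α E : Type*} [MeasurableSpace α] [NormedAddCommGroup E]
    [InnerProductSpace ℝ E] {μ : Measure α} {p q : ℝ} (hpq : p.HolderConjugate q) {f g : α → E}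
    (hf : MemLp f (.ofReal p) μ) (hg : MemLp g (.ofReal q) μ) :
    |∫ x, ⟪f x, g x⟫ ∂μ| ≤ lpNorm f (.ofReal p) μ * lpNorm g (.ofReal q) μ := by
  have e : ∀ {r : ℝ} {h : α → E}, 0 < r → MemLp h (.ofReal r) μ →
      (∫ x, ‖h x‖ ^ r ∂μ) ^ (1 / r) = lpNorm h (.ofReal r) μ := fun hr hh => by
    rw [← lpNorm_rpow hr hh.1, one_div, Real.rpow_rpow_inv lpNorm_nonneg hr.ne']
  have h1 := integral_mul_norm_le_Lp_mul_Lq hpq hf hg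
  rw [e hpq.pos hf, e hpq.symm.pos hg] at h1
  refine le_trans ?_ h1
  refine abs_integral_le_integral_abs.trans ?_
  refine integral_mono (integrable_inner_of_memLp hpq hf hg).abs ?_
    fun x => abs_real_inner_le_norm _ _
  have := hpq.ennrealOfReal
  exact memLp_one_iff_integrable.1 (hg.norm.mul (r := 1) hf.norm)

/-! ### The multiplier of a KKT pair -/

lemma isWeakDiv_test {Ω : Set (Vec d)} {φ : Vec d → ℝ} (hφ : IsTest Ω φ) (i k : Fin d) :
    IsWeakDiv Ω (fun x => φ x • EuclideanSpace.single (i, k) (1 : ℝ))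
      (fun x => fderiv ℝ φ x (EuclideanSpace.single k 1) • EuclideanSpace.single i (1 : ℝ)) := by
  have hφk := hφ.fderiv_apply (EuclideanSpace.single k 1)
  refine ⟨(hφ.smooth.continuous.smul continuous_const).locallyIntegrable.locallyIntegrableOn _,
    (hφk.smooth.continuous.smul continuous_const).locallyIntegrable.locallyIntegrableOn _,
    fun ψ hψ l => ?_⟩
  have hrow : ∀ x, row (fun x => φ x • EuclideanSpace.single (i, k) (1 : ℝ)) l x
      = if l = i then φ x • EuclideanSpace.single k (1 : ℝ) else 0 := fun x => by
    ext m
    by_cases hl : l = i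
    · subst hl
      simp [row]
    · simp [row, hl]
  by_cases hl : l = i
  · subst hl
    have h1 := hφ.isWeakGrad.byParts ψ hψ (EuclideanSpace.single k 1)
    have hgr : ∀ (φ : Vec d → ℝ) x v, ⟪v, gradient φ x⟫ = fderiv ℝ φ x v := fun φ x v => by
      rw [real_inner_comm]
      simp [gradient]
    simp only [real_inner_comm _ (gradient φ _), hgr] at h1
    simp only [hrow, if_true, hgr, map_smul, smul_eq_mul]
    rw [h1]
    simp
  · simp [hrow, hl]

/-- For such a field the vanishing trace is the defining identity of the weak derivative of `χ_i` in
direction `k`. Testing with these fields isolates single matrix entries. -/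
lemma memSigma0_test {Ω : Set (Vec d)} (hΩ : IsOpen Ω) {p q : ℝ}
    {φ : Vec d → ℝ} (hφ : IsTest Ω φ) (i k : Fin d) :
    MemSigma0 p q Ω (fun x => φ x • EuclideanSpace.single (i, k) (1 : ℝ)) := by
  have hD := isWeakDiv_test hφ i k
  refine ⟨⟨(ContinuousLinearMap.toSpanSingleton ℝ _).comp_memLp' (hφ.memLp _), _, hD,
    (ContinuousLinearMap.toSpanSingleton ℝ _).comp_memLp' ((hφ.fderiv_apply _).memLp _)⟩,
    fun χ hχ => ?_⟩
  have h1 := (hχ i).isWeakGrad.byParts φ hφ (EuclideanSpace.single k 1)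
  have h2 : ∫ x in Ω, ⟪weakDiv Ω (fun x => φ x • EuclideanSpace.single (i, k) (1 : ℝ)) x, χ x⟫
      = ∫ x in Ω, χ x i * fderiv ℝ φ x (EuclideanSpace.single k 1) := by
    refine integral_congr_ae ?_
    filter_upwards [hD.weakDiv_ae hΩ] with x hx
    rw [hx, real_inner_smul_left, EuclideanSpace.inner_single_left]
    simp [mul_comm]
  rw [normalTrace, h2, h1]
  simp [real_inner_smul_left, EuclideanSpace.inner_single_left, EuclideanSpace.inner_single_right,
    weakJac]

/-- The Jacobian of the multiplier of a KKT pair `(S, θ)` is `|S - K|^{p-2} (S - K)`. -/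
lemma IsKKT.weakJac_ae {Ω : Set (Vec d)} (hΩ : IsOpen Ω) {p q : ℝ} (hpq : p.HolderConjugate q)
    {f ju u y : Vec d → ℝ} (hK : MemLp (shapeTensor Ω u y) (.ofReal p) (vol Ω))
    {S : Vec d → Mat d} {θ : Vec d → Vec d} (h : IsKKT p q Ω f ju u y S θ) :
    weakJac Ω θ =ᵐ[vol Ω]
      fun x => ‖S x - shapeTensor Ω u y x‖ ^ (p - 2) • (S x - shapeTensor Ω u y x) := by
  have hM := memLp_duality_map hpq (h.admissible.1.sub hK)
  simp only [Pi.sub_apply] at hM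
  set M := fun x => ‖S x - shapeTensor Ω u y x‖ ^ (p - 2) • (S x - shapeTensor Ω u y x)
  have hq1 := one_le_ofReal_of_holderConjugate hpq
  have key : ∀ i, weakGrad Ω (fun x => θ x i) =ᵐ[vol Ω] fun x => rowL d i (M x) := by
    intro i
    refine ae_eq_of_forall_test hΩ
      (locallyIntegrableOn_of_memLp hq1 ((h.memW1 i).memLp_weakGrad hΩ))
      (locallyIntegrableOn_of_memLp hq1 ((rowL d i).comp_memLp' hM)) fun φ hφ k => ?_
    -- Stationarity and the vanishing trace contain the same divergence term; subtracting them
    -- leaves entry `(i, k)` of `M` and of `∇θ` with equal integrals against `φ`.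
    have h1 := h.stationary _ (memSigma0_test hΩ hφ i k)
    have h2 := (memSigma0_test (p := p) (q := q) hΩ hφ i k).2 θ h.memW1
    rw [normalTrace] at h2
    have h3 : ∫ x in Ω, ⟪M x, φ x • EuclideanSpace.single (i, k) (1 : ℝ)⟫
        = ∫ x in Ω, φ x * rowL d i (M x) k := by
      refine integral_congr_ae (.of_forall fun x => ?_)
      simp [real_inner_smul_right, EuclideanSpace.inner_single_right]
    have h4 : ∫ x in Ω, ⟪φ x • EuclideanSpace.single (i, k) (1 : ℝ), weakJac Ω θ x⟫
        = ∫ x in Ω, φ x * weakGrad Ω (fun x => θ x i) x k := by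
      refine integral_congr_ae (.of_forall fun x => ?_)
      simp [real_inner_smul_left, EuclideanSpace.inner_single_left, weakJac]
    rw [h3] at h1
    rw [h4] at h2
    linarith
  filter_upwards [ae_all_iff.2 key] with x hx
  ext ⟨i, k⟩
  exact congrArg (fun v : Vec d => v k) (hx i)

/-- The identity matrix. -/
def idMat (d : ℕ) : Mat d := WithLp.toLp 2 fun ik => if ik.1 = ik.2 then 1 else 0

lemma inner_idMat (M : Mat d) : ⟪idMat d, M⟫ = ∑ i, M (i, i) := by
  simp [idMat, PiLp.inner_apply, Fintype.sum_prod_type]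

/-- The identity field lies in every Sobolev space over a bounded set. -/
lemma memW1Vec_id {Ω : Set (Vec d)} (hΩb : Bornology.IsBounded Ω) [IsFiniteMeasure (vol Ω)]
    (hΩ : IsOpen Ω) (r : ℝ≥0∞) :
    MemW1Vec r Ω id ∧ weakJac Ω id =ᵐ[vol Ω]
      fun _ => idMat d := by
  have hg : ∀ i, IsWeakGrad Ω (fun x : Vec d => x i) fun _ => EuclideanSpace.single i 1 := by
    intro i
    simpa [EuclideanSpace.inner_single_left] using
      isWeakGrad_inner Ω (EuclideanSpace.single i (1 : ℝ))
  obtain ⟨C, hC⟩ := hΩb.exists_norm_le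
  refine ⟨fun i => ⟨?_, _, hg i, memLp_const _⟩, weakJac_ae hΩ fun i => ?_⟩
  · have : MemLp (id : Vec d → Vec d) r (vol Ω) := by
      refine MemLp.of_bound continuous_id.aestronglyMeasurable C ?_
      exact (ae_restrict_iff' hΩ.measurableSet).2 (.of_forall hC)
    exact this.eval_piLp i
  · have e : rowL d i (idMat d) = EuclideanSpace.single i 1 := by
      ext k
      simp [idMat, eq_comm]
    rw [e]
    exact hg i

/-- Admissibility replaces the load by `-(T, ∇χ)`, so the shape derivative sees only `∇χ` and the
defect `T - K`. -/
lemma IsAdmissible.shapeDeriv_eq {Ω : Set (Vec d)} (hΩ : IsOpen Ω) {p q : ℝ}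
    (hpq : p.HolderConjugate q) {f ju u y : Vec d → ℝ}
    (hK : MemLp (shapeTensor Ω u y) (.ofReal p) (vol Ω)) {T : Vec d → Mat d}
    (hT : IsAdmissible p q Ω f ju y T) {χ : Vec d → Vec d} (hχ : MemW1Vec (.ofReal q) Ω χ) :
    shapeDeriv Ω f ju u y χ = - ∫ x in Ω, ⟪T x - shapeTensor Ω u y x, weakJac Ω χ x⟫ := by
  have hJ := hχ.memLp_weakJac hΩ
  simp only [inner_sub_left]
  rw [shapeDeriv, ← hT.2 χ hχ, integral_sub (integrable_inner_of_memLp hpq hT.1 hJ)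
    (integrable_inner_of_memLp hpq hK hJ)]
  ring

/-- Existence of a solution of the KKT system. -/
theorem exists_isKKT {Ω : Set (Vec d)} (hΩ : IsOpen Ω) (hΩc : IsConnected Ω)
    [IsFiniteMeasure (vol Ω)] {p q : ℝ} (hpq : p.HolderConjugate q) (hp2 : p ≤ 2)
    (hH : HasHelmholtz p q Ω) {f ju u y : Vec d → ℝ} (hf : MemLp f ⊤ (vol Ω))
    (hy : MemLp (weakGrad Ω y) 2 (vol Ω)) (hju : MemLp ju 2 (vol Ω))
    (hK : MemLp (shapeTensor Ω u y) (.ofReal p) (vol Ω))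
    (hcompat : ∀ e : Vec d, ∫ x in Ω, f x * ⟪weakGrad Ω y x, e⟫ = 0) :
    ∃ S θ, IsKKT p q Ω f ju u y S θ := by
  have hp2' : ENNReal.ofReal p ≤ 2 := by
    simpa using ENNReal.ofReal_le_ofReal hp2
  have hb : MemLp (fun x => f x • weakGrad Ω y x) (.ofReal p) (vol Ω) :=
    (hy.smul (r := 2) hf).mono_exponent hp2'
  -- `(j, div χ) = (j I, ∇χ)`, so this part of the load joins `K` and only `(f ∇y, χ)` still depends
  -- on `χ` itself.
  have hjuI : MemLp (fun x => ju x • idMat d) (.ofReal p) (vol Ω) :=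
    (ContinuousLinearMap.toSpanSingleton ℝ _).comp_memLp' (hju.mono_exponent hp2')
  have hJ : ∀ χ, MemW1Vec (.ofReal q) Ω χ → shapeDeriv Ω f ju u y χ =
      (∫ x in Ω, ⟪(shapeTensor Ω u y + fun x => ju x • idMat d) x, weakJac Ω χ x⟫)
        + ∫ x in Ω, ⟪f x • weakGrad Ω y x, χ x⟫ := by
    intro χ hχ
    have e1 := integrable_inner_of_memLp hpq hK (hχ.memLp_weakJac hΩ)
    have e2 := integrable_inner_of_memLp hpq hjuI (hχ.memLp_weakJac hΩ)
    simp only [Pi.add_apply, inner_add_left]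
    rw [integral_add e1 e2, shapeDeriv, loadFunctional]
    simp only [real_inner_smul_left, inner_idMat, divW1]
    ring
  obtain ⟨θ, hθ, hmin⟩ := exists_energy_minimizer hΩ hΩc hpq hp2 hH (hK.add hjuI) hb
    (fun e => by simpa only [real_inner_smul_left] using hcompat e)
  have hθJ := hθ.memLp_weakJac hΩ
  have hN := memLp_duality_map hpq.symm hθJ
  -- The Euler–Lagrange equation, obtained by comparing `θ` with `θ + t • χ`.
  have hEL : ∀ χ, MemW1Vec (.ofReal q) Ω χ →
      (∫ x in Ω, ⟪‖weakJac Ω θ x‖ ^ (q - 2) • weakJac Ω θ x, weakJac Ω χ x⟫)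
        + shapeDeriv Ω f ju u y χ = 0 := by
    intro χ hχ
    have hχJ := hχ.memLp_weakJac hΩ
    simp only [real_inner_smul_left]
    refine integral_norm_rpow_inner_eq hpq.symm.lt hθJ hχJ fun t => ?_
    have h1 := hmin _ (hθ.add (hχ.const_smul t))
    have h2 := (weakJac_add_ae hΩ hθ (hχ.const_smul t)).trans
      (EventuallyEq.rfl.add (weakJac_const_smul_ae hΩ hχ t))
    have e1 : ∫ x in Ω, ‖weakJac Ω (θ + t • χ) x‖ ^ q
        = ∫ x in Ω, ‖weakJac Ω θ x + t • weakJac Ω χ x‖ ^ q := by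
      refine integral_congr_ae ?_
      filter_upwards [h2] with x hx
      rw [hx]
      rfl
    have e2 : ∫ x in Ω, ⟪(shapeTensor Ω u y + fun x => ju x • idMat d) x,
          weakJac Ω (θ + t • χ) x⟫
        = (∫ x in Ω, ⟪(shapeTensor Ω u y + fun x => ju x • idMat d) x, weakJac Ω θ x⟫)
          + t * ∫ x in Ω, ⟪(shapeTensor Ω u y + fun x => ju x • idMat d) x, weakJac Ω χ x⟫ := by
      rw [← integral_const_mul, ← integral_add
        (integrable_inner_of_memLp hpq (hK.add hjuI) hθJ)
        ((integrable_inner_of_memLp hpq (hK.add hjuI) hχJ).const_mul t)]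
      refine integral_congr_ae ?_
      filter_upwards [h2] with x hx
      rw [hx, ← real_inner_smul_right, ← inner_add_right]
      rfl
    have e3 : ∫ x in Ω, ⟪f x • weakGrad Ω y x, (θ + t • χ) x⟫
        = (∫ x in Ω, ⟪f x • weakGrad Ω y x, θ x⟫)
          + t * ∫ x in Ω, ⟪f x • weakGrad Ω y x, χ x⟫ := by
      rw [← integral_const_mul, ← integral_add
        (integrable_inner_of_memLp hpq hb hθ.memLp)
        ((integrable_inner_of_memLp hpq hb hχ.memLp).const_mul t)]
      refine integral_congr_ae (.of_forall fun x => ?_)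
      simp only [Pi.add_apply, Pi.smul_apply, inner_add_right, real_inner_smul_right]
    rw [e1, e2, e3] at h1
    rw [hJ χ hχ]
    linarith
  -- With this choice of `S` the Euler–Lagrange equation is admissibility, and the inverse duality
  -- map turns `|S - K|^{p-2} (S - K)` back into `∇θ`, so that stationarity becomes the zero normal
  -- trace of `T`.
  refine ⟨fun x => shapeTensor Ω u y x + ‖weakJac Ω θ x‖ ^ (q - 2) • weakJac Ω θ x, θ,
    ⟨hK.add hN, fun χ hχ => ?_⟩, hθ, fun T hT => ?_⟩
  · have hχJ := hχ.memLp_weakJac hΩ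
    have h1 := hEL χ hχ
    simp only [inner_add_left]
    rw [integral_add (integrable_inner_of_memLp hpq hK hχJ)
      (integrable_inner_of_memLp hpq hN hχJ)]
    rw [shapeDeriv] at h1
    linarith
  · have h1 := hT.2 θ hθ
    rw [normalTrace] at h1
    simpa only [add_sub_cancel_left, duality_map_leftInverse hpq, real_inner_comm] using h1

/-! ### Norm identities and duality for KKT pairs -/

section KKT

variable {Ω : Set (Vec d)} {p q : ℝ} {f ju u y : Vec d → ℝ} {S : Vec d → Mat d}
  {θ : Vec d → Vec d}

lemma IsKKT.lpNorm_weakJac_rpow (h : IsKKT p q Ω f ju u y S θ) (hΩ : IsOpen Ω)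
    (hpq : p.HolderConjugate q) (hK : MemLp (shapeTensor Ω u y) (.ofReal p) (vol Ω)) :
    lpNorm (weakJac Ω θ) (.ofReal q) (vol Ω) ^ q
      = lpNorm (fun x => S x - shapeTensor Ω u y x) (.ofReal p) (vol Ω) ^ p := by
  rw [lpNorm_rpow hpq.symm.pos (h.memW1.memLp_weakJac hΩ).1,
    lpNorm_rpow (f := fun x => S x - shapeTensor Ω u y x) hpq.pos
      (h.admissible.1.sub hK).1]
  refine integral_congr_ae ?_
  filter_upwards [h.weakJac_ae hΩ hpq hK] with x hx
  rw [hx, norm_duality_map_rpow hpq]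

lemma IsKKT.lpNorm_weakJac (h : IsKKT p q Ω f ju u y S θ) (hΩ : IsOpen Ω)
    (hpq : p.HolderConjugate q) (hK : MemLp (shapeTensor Ω u y) (.ofReal p) (vol Ω)) :
    lpNorm (weakJac Ω θ) (.ofReal q) (vol Ω)
      = lpNorm (fun x => S x - shapeTensor Ω u y x) (.ofReal p) (vol Ω) ^ (p - 1) := by
  refine (Real.rpow_left_inj lpNorm_nonneg (Real.rpow_nonneg lpNorm_nonneg _)
    hpq.symm.ne_zero).1 ?_
  rw [h.lpNorm_weakJac_rpow hΩ hpq hK, ← Real.rpow_mul lpNorm_nonneg, hpq.sub_one_mul_conj]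

/-- Equality in Hölder: `(S - K, ∇θ) = ∫ |S - K|^p`, and `‖S - K‖_p^p` splits as `‖S - K‖_p` times
`‖S - K‖_p^{p-1} = ‖∇θ‖_q`. -/
lemma IsKKT.shapeDeriv_eq (h : IsKKT p q Ω f ju u y S θ) (hΩ : IsOpen Ω)
    (hpq : p.HolderConjugate q) (hK : MemLp (shapeTensor Ω u y) (.ofReal p) (vol Ω)) :
    - shapeDeriv Ω f ju u y θ
      = lpNorm (fun x => S x - shapeTensor Ω u y x) (.ofReal p) (vol Ω)
        * lpNorm (weakJac Ω θ) (.ofReal q) (vol Ω) := by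
  rw [h.lpNorm_weakJac hΩ hpq hK, mul_comm,
    ← Real.rpow_add_one' lpNorm_nonneg (by linarith [hpq.pos]), sub_add_cancel,
    lpNorm_rpow (f := fun x => S x - shapeTensor Ω u y x) hpq.pos
      (h.admissible.1.sub hK).1, h.admissible.shapeDeriv_eq hΩ hpq hK h.memW1,
    neg_neg]
  refine integral_congr_ae ?_
  filter_upwards [h.weakJac_ae hΩ hpq hK] with x hx
  rw [hx, inner_duality_map hpq.lt]

/-- Weak duality, by Hölder; it is used both to bound the supremum and to show that no admissible
field is closer to `K` than `S`. -/
lemma IsAdmissible.abs_shapeDeriv_le {T : Vec d → Mat d} (hT : IsAdmissible p q Ω f ju y T)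
    (hΩ : IsOpen Ω) (hpq : p.HolderConjugate q)
    (hK : MemLp (shapeTensor Ω u y) (.ofReal p) (vol Ω)) {χ : Vec d → Vec d}
    (hχ : MemW1Vec (.ofReal q) Ω χ) :
    |shapeDeriv Ω f ju u y χ| ≤ lpNorm (fun x => T x - shapeTensor Ω u y x) (.ofReal p) (vol Ω)
      * lpNorm (weakJac Ω χ) (.ofReal q) (vol Ω) := by
  rw [hT.shapeDeriv_eq hΩ hpq hK hχ, abs_neg]
  exact abs_integral_inner_le hpq (hT.1.sub hK) (hχ.memLp_weakJac hΩ)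

/-- The tensor field of a KKT pair attains the distance `η_p(Ω)`. -/
lemma IsKKT.eta_eq (h : IsKKT p q Ω f ju u y S θ) (hΩ : IsOpen Ω)
    (hpq : p.HolderConjugate q) (hK : MemLp (shapeTensor Ω u y) (.ofReal p) (vol Ω)) :
    eta p q Ω f ju u y = lpNorm (fun x => S x - shapeTensor Ω u y x) (.ofReal p) (vol Ω) := by
  refine IsLeast.csInf_eq ⟨⟨S, h.admissible, rfl⟩, ?_⟩
  rintro _ ⟨T, hT, rfl⟩
  have h0 : 0 ≤ lpNorm (fun x => S x - shapeTensor Ω u y x) (.ofReal p) (vol Ω) := lpNorm_nonneg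
  rcases h0.eq_or_lt with h0 | h0
  · rw [← h0]; exact lpNorm_nonneg
  · have hpos : 0 < lpNorm (weakJac Ω θ) (.ofReal q) (vol Ω) := by
      rw [h.lpNorm_weakJac hΩ hpq hK]
      positivity
    refine le_of_mul_le_mul_right ?_ hpos
    rw [← h.shapeDeriv_eq hΩ hpq hK]
    exact (neg_le_abs _).trans (hT.abs_shapeDeriv_le hΩ hpq hK h.memW1)

/-- The dual norm of the shape derivative equals `η_p(Ω)`. -/
lemma IsKKT.isLUB (h : IsKKT p q Ω f ju u y S θ) (hd : 0 < d) (hΩ : IsOpen Ω)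
    (hne : Ω.Nonempty) (hΩb : Bornology.IsBounded Ω) [IsFiniteMeasure (vol Ω)]
    (hpq : p.HolderConjugate q) (hK : MemLp (shapeTensor Ω u y) (.ofReal p) (vol Ω)) :
    IsLUB {r : ℝ | ∃ χ, MemW1Vec (.ofReal q) Ω χ ∧
        lpNorm (weakJac Ω χ) (.ofReal q) (vol Ω) ≠ 0 ∧
        r = shapeDeriv Ω f ju u y χ / lpNorm (weakJac Ω χ) (.ofReal q) (vol Ω)}
      (eta p q Ω f ju u y) := by
  have hbound : ∀ χ, MemW1Vec (.ofReal q) Ω χ → _ := fun χ hχ =>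
    h.admissible.abs_shapeDeriv_le hΩ hpq hK hχ
  rw [h.eta_eq hΩ hpq hK]
  have hval := h.shapeDeriv_eq hΩ hpq hK
  have hG := h.lpNorm_weakJac hΩ hpq hK
  have h0 : 0 ≤ lpNorm (fun x => S x - shapeTensor Ω u y x) (.ofReal p) (vol Ω) := lpNorm_nonneg
  set N := lpNorm (fun x => S x - shapeTensor Ω u y x) (.ofReal p) (vol Ω)
  constructor
  · rintro _ ⟨χ, hχ, hχ0, rfl⟩
    exact (div_le_iff₀ (lt_of_le_of_ne lpNorm_nonneg hχ0.symm)).2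
      ((le_abs_self _).trans (hbound χ hχ))
  · intro B hB
    rcases h0.eq_or_lt with h0 | h0
    -- If the distance is `0`, then `∇θ = 0` and `θ` is no competitor. All quotients vanish, but the
    -- set must be shown nonempty: the identity field serves, as `d > 0` and `Ω` has positive
    -- measure.
    · obtain ⟨hid, hidJ⟩ := memW1Vec_id hΩb hΩ (.ofReal q)
      refine h0.symm.le.trans (hB ⟨id, hid, fun hzero => ?_, ?_⟩)
      · rw [lpNorm_eq_zero (hid.memLp_weakJac hΩ) (by simpa using hpq.symm.pos)] at hzero
        have hμ : vol Ω ≠ 0 := by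
          rw [Ne, Measure.restrict_eq_zero]
          exact (hΩ.measure_pos volume hne).ne'
        have : NeBot (ae (vol Ω)) := ae_neBot.2 hμ
        obtain ⟨x, hx1, hx2⟩ := (hidJ.and hzero).exists
        rw [hx1] at hx2
        have := congrArg (fun M : Mat d => M (⟨0, hd⟩, ⟨0, hd⟩)) hx2
        simp [idMat] at this
      · have := hbound id hid
        rw [← h0, zero_mul] at this
        rw [abs_nonpos_iff.1 this, zero_div]
    · have hpos : 0 < lpNorm (weakJac Ω θ) (.ofReal q) (vol Ω) := by
        rw [hG]
        positivity
      -- The multiplier is a descent direction, so the supremum is attained at `-θ`.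
      have hneg := h.memW1.const_smul (-1)
      have hJ := weakJac_const_smul_ae hΩ h.memW1 (-1)
      have e1 : lpNorm (weakJac Ω ((-1 : ℝ) • θ)) (.ofReal q) (vol Ω)
          = lpNorm (weakJac Ω θ) (.ofReal q) (vol Ω) := by
        rw [← toReal_eLpNorm (hneg.memLp_weakJac hΩ).1, eLpNorm_congr_ae hJ, neg_one_smul,
          eLpNorm_neg, toReal_eLpNorm (h.memW1.memLp_weakJac hΩ).1]
      have e2 : shapeDeriv Ω f ju u y ((-1 : ℝ) • θ) = - shapeDeriv Ω f ju u y θ := by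
        rw [h.admissible.shapeDeriv_eq hΩ hpq hK hneg,
          h.admissible.shapeDeriv_eq hΩ hpq hK h.memW1]
        refine congrArg Neg.neg ?_
        rw [← integral_neg]
        refine integral_congr_ae ?_
        filter_upwards [hJ] with x hx
        rw [hx]
        simp
      refine hB ⟨(-1 : ℝ) • θ, hneg, by rw [e1]; exact hpos.ne', ?_⟩
      rw [e1, e2, hval, mul_div_cancel_right₀ _ hpos.ne']

end KKT

end ShapeLp

end

/-! ### The main theorem -/

theorem theorem3p4 {d : ℕ} (hd : 0 < d)
    (Ω : Set (Vec d)) (hΩo : IsOpen Ω) (hΩc : IsConnected Ω) (hΩb : Bornology.IsBounded Ω)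
    (p q : ℝ) (hpq : p.HolderConjugate q) (hp2 : p ≤ 2)
    (hHelmholtz : HasHelmholtz p q Ω)
    (f : Vec d → ℝ) (hf : MemLp f ⊤ (vol Ω))
    (j j' : (Vec d → ℝ) → (Vec d → ℝ)) (hj : IsShapeIntegrand Ω j j')
    (u y : Vec d → ℝ)
    (hu : IsDirichletSolution Ω f u)
    (hy : IsDirichletSolution Ω (fun x => - j' u x) y)
    (hju : MemLp (j u) 2 (vol Ω))
    (hK : MemLp (shapeTensor Ω u y) (.ofReal p) (vol Ω))
    (hcompat : ∀ e : Vec d, ∫ x in Ω, f x * ⟪weakGrad Ω y x, e⟫ = 0) :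
    (∃ S θ, IsKKT p q Ω f (j u) u y S θ) ∧
    IsLUB {r : ℝ | ∃ χ, MemW1Vec (.ofReal q) Ω χ ∧
        lpNorm (weakJac Ω χ) (.ofReal q) (vol Ω) ≠ 0 ∧
        r = shapeDeriv Ω f (j u) u y χ / lpNorm (weakJac Ω χ) (.ofReal q) (vol Ω)}
      (eta p q Ω f (j u) u y) ∧
    ∀ S θ, IsKKT p q Ω f (j u) u y S θ →
      (lpNorm (weakJac Ω θ) (.ofReal q) (vol Ω) = 0 ↔ eta p q Ω f (j u) u y = 0) ∧
      (lpNorm (weakJac Ω θ) (.ofReal q) (vol Ω) ≠ 0 →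
        - (shapeDeriv Ω f (j u) u y θ / lpNorm (weakJac Ω θ) (.ofReal q) (vol Ω))
          = eta p q Ω f (j u) u y) := by
  have hfin : IsFiniteMeasure (vol Ω) :=
    isFiniteMeasure_restrict.2 hΩb.measure_lt_top.ne
  refine ⟨exists_isKKT hΩo hΩc hpq hp2 hHelmholtz hf (hy.mem.1.memLp_weakGrad hΩo) hju hK hcompat,
    ?_, fun S θ h => ⟨?_, fun hne => ?_⟩⟩
  · obtain ⟨S, θ, h⟩ := exists_isKKT hΩo hΩc hpq hp2 hHelmholtz hf
      (hy.mem.1.memLp_weakGrad hΩo) hju hK hcompat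
    exact h.isLUB hd hΩo hΩc.nonempty hΩb hpq hK
  -- The norm of `∇θ` is `η_p^{p-1}` with `p - 1 > 0`, so both vanish together.
  · rw [h.lpNorm_weakJac hΩo hpq hK, h.eta_eq hΩo hpq hK,
      Real.rpow_eq_zero lpNorm_nonneg hpq.sub_one_pos.ne']
  · rw [h.eta_eq hΩo hpq hK, ← neg_div, h.shapeDeriv_eq hΩo hpq hK, mul_div_cancel_right₀ _ hne]
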